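/- Let $n\ge 2$ be an integer. There is a constant $C>0$, depending only on $n$, with the following property. Let $\Sigma\subset\mathbb Z^n$ be a finite set, let $\mathcal C\subseteq\mathbb R^n$ be a nonempty open cone (that is, $tx\in\mathcal C$ for all $t\in(0,\infty)$ and $x\in\mathcal C$), and let $f:\mathbb S^{n-1}\to\mathbb R^n$ be a continuous map that belongs to the Sobolev space $W^{1,n-1}(\mathbb S^{n-1},\mathbb R^n)$ and satisfies $|f(x)-\sigma|\ge \tfrac12$ for every $x\in\mathbb S^{n-1}$ and every $\sigma\in\Sigma$. Then $$\Bigl(\sum_{\sigma\in\Sigma}|\deg_\sigma(f)|\Bigr)^{1-\frac1n}\le\frac{C}{\mathcal H^{n-1}(\mathcal C\cap\mathbb S^{n-1})}\int_{f^{-1}(\mathcal C+\Sigma)}|\mathrm Df|^{n-1}\,\mathrm d\mathcal H^{n-1}.$$ Here $\mathrm Df$ is the weak derivative of $f$ on $\mathbb S^{n-1}$, $|\mathrm Df|$ is its operator norm on the tangent space, $\mathcal H^{n-1}$ is the $(n-1)$-dimensional Hausdorff measure, $\mathcal C+\Sigma=\{x+\sigma : x\in\mathcal C,\ \sigma\in\Sigma\}$,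 and $\deg_\sigma(f)$ is the Brouwer degree of the continuous map $(f-\sigma)/|f-\sigma|:\mathbb S^{n-1}\to\mathbb S^{n-1}$. -/

import Mathlib

open MeasureTheory Metric Set
open scoped Pointwise ContDiff

/-- Euclidean space `ℝⁿ`. -/
abbrev Euc (n : ℕ) : Type := EuclideanSpace ℝ (Fin n)

/-- The unit sphere `𝕊ⁿ⁻¹ ⊆ ℝⁿ`. -/
abbrev Sph (n : ℕ) : Type := sphere (0 : Euc n) 1

/-- A point of the lattice `ℤⁿ`, seen in `ℝⁿ`. -/
def latticePoint {n : ℕ} (σ : Fin n → ℤ) : Euc n :=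
  WithLp.toLp 2 (fun i => (σ i : ℝ))

/-- A cone: a set stable under multiplication by every `t ∈ (0, ∞)`. -/
def IsCone {n : ℕ} (C : Set (Euc n)) : Prop :=
  ∀ t : ℝ, 0 < t → ∀ x ∈ C, t • x ∈ C

/-! ### Brouwer degree -/

lemma normalize_mem_sphere {n : ℕ} {v : Euc n} (hv : v ≠ 0) :
    ‖v‖⁻¹ • v ∈ sphere (0 : Euc n) 1 := by
  rw [mem_sphere_zero_iff_norm, norm_smul, norm_inv, norm_norm,
    inv_mul_cancel₀ (norm_ne_zero_iff.mpr hv)]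

open Classical in
/-- The positively `1`-homogeneous extension `x ↦ |x| g(x/|x|)` of `g : 𝕊ⁿ⁻¹ → 𝕊ⁿ⁻¹` to `ℝⁿ`.
At a point `x` of the sphere its derivative maps `x` to `g x` and restricts to the tangential
derivative `T_x 𝕊ⁿ⁻¹ → T_{g x} 𝕊ⁿ⁻¹` of `g`. Hence its determinant is that of the tangential
derivative, computed with the orientation of the sphere induced by that of `ℝⁿ`. -/
noncomputable def homExt {n : ℕ} (g : C(Sph n, Sph n)) (x : Euc n) : Euc n :=
  if hx : x = 0 then 0 else ‖x‖ • (g ⟨‖x‖⁻¹ • x, normalize_mem_sphere hx⟩ : Euc n)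

/-- The Jacobian determinant at `x` of `g : 𝕊ⁿ⁻¹ → 𝕊ⁿ⁻¹`, on oriented tangent spaces. -/
noncomputable def sphereJac {n : ℕ} (g : C(Sph n, Sph n)) (x : Sph n) : ℝ :=
  (fderiv ℝ (homExt g) (x : Euc n)).det

/-- `d` is the Brouwer degree of the continuous map `f : 𝕊ⁿ⁻¹ → 𝕊ⁿ⁻¹`: for some smooth map `g`
homotopic to `f` and some regular value `y` of `g`, `d` is the number of preimages of `y`
under `g`, counted with the sign of the Jacobian determinant of `g`.
(By classical differential topology there is one and only one such `d`, and every choice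
of `g` and `y` gives it.) -/
def IsBrouwerDegree {n : ℕ} (f : C(Sph n, Sph n)) (d : ℤ) : Prop :=
  ∃ g : C(Sph n, Sph n), f.Homotopic g ∧ ContDiffOn ℝ ∞ (homExt g) {0}ᶜ ∧
    ∃ (y : Sph n) (P : Finset (Sph n)), (∀ x, x ∈ P ↔ g x = y) ∧
      (∀ x ∈ P, sphereJac g x ≠ 0) ∧
      d = ∑ x ∈ P, (SignType.sign (sphereJac g x) : ℤ)

open Classical in
/-- The Brouwer degree of a continuous map `𝕊ⁿ⁻¹ → 𝕊ⁿ⁻¹`. -/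
noncomputable def brouwerDegree {n : ℕ} (f : C(Sph n, Sph n)) : ℤ :=
  if h : ∃ d, IsBrouwerDegree f d then h.choose else 0

/-- The map `(f - p) / |f - p| : 𝕊ⁿ⁻¹ → 𝕊ⁿ⁻¹`, for `f : 𝕊ⁿ⁻¹ → ℝⁿ` avoiding `p`. -/
noncomputable def normalizedMap {n : ℕ} (f : C(Sph n, Euc n)) (p : Euc n)
    (h : ∀ x, f x ≠ p) : C(Sph n, Sph n) where
  toFun x := ⟨‖f x - p‖⁻¹ • (f x - p), normalize_mem_sphere (sub_ne_zero.mpr (h x))⟩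
  continuous_toFun := by
    have h1 : Continuous fun x => f x - p := f.continuous.sub continuous_const
    exact ((h1.norm.inv₀ fun x => norm_ne_zero_iff.mpr (sub_ne_zero.mpr (h x))).smul
      h1).subtype_mk _

open Classical in
/-- The degree `deg_p f = deg ((f - p) / |f - p|)` with respect to the point `p` of a continuous
map `f : 𝕊ⁿ⁻¹ → ℝⁿ` that avoids `p` (and `0`, by convention, if `f` takes the value `p`). -/
noncomputable def degAt {n : ℕ} (p : Euc n) (f : C(Sph n, Euc n)) : ℤ :=
  if h : ∀ x, f x ≠ p then brouwerDegree (normalizedMap f p h) else 0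

/-! ### Sobolev maps on the sphere -/

/-- The `(n-1)`-dimensional Hausdorff measure on the sphere `𝕊ⁿ⁻¹`. -/
noncomputable def sphMeasure (n : ℕ) : Measure (Sph n) :=
  Measure.hausdorffMeasure ((n : ℝ) - 1)

/-- The tangential divergence at the point `x` of the unit sphere of a vector field `X` on `ℝⁿ`:
the trace of `DX(x)` minus its normal part. -/
noncomputable def sphereDiv {n : ℕ} (X : Euc n → Euc n) (x : Euc n) : ℝ :=
  LinearMap.trace ℝ (Euc n) (fderiv ℝ X x : Euc n →ₗ[ℝ] Euc n) - inner ℝ (fderiv ℝ X x x) x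

/-- `A` is the weak derivative of `f : 𝕊ⁿ⁻¹ → ℝⁿ`. The linear map `A x`, defined on the tangent
space at `x`, is extended to `ℝⁿ` by `0` in the normal direction (so that its operator norm is the
one on the tangent space), and `∫ A X = - ∫ (div X) f` for each smooth tangential field `X`. -/
structure IsWeakDeriv {n : ℕ} (f : Sph n → Euc n) (A : Sph n → Euc n →L[ℝ] Euc n) : Prop where
  integrable : Integrable A (sphMeasure n)
  tangential : ∀ᵐ x ∂(sphMeasure n), A x (x : Euc n) = 0
  integral_eq : ∀ X : Euc n → Euc n, ContDiff ℝ ∞ X →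
    (∀ x : Sph n, inner ℝ (X x) (x : Euc n) = 0) →
    ∫ x : Sph n, A x (X x) ∂(sphMeasure n) = - ∫ x : Sph n, sphereDiv X x • f x ∂(sphMeasure n)

/-- `f ∈ W^{1,p}(𝕊ⁿ⁻¹, ℝⁿ)`, with weak derivative `A`. -/
structure IsSobolev {n : ℕ} (p : ENNReal) (f : Sph n → Euc n) (A : Sph n → Euc n →L[ℝ] Euc n) :
    Prop where
  memLp : MemLp f p (sphMeasure n)
  weakDeriv : IsWeakDeriv f A
  memLp_deriv : MemLp A p (sphMeasure n)

/-! Write `D` for the sum of the `|deg_σ f|`. For one point `σ`, the degree counts how often `f - σ`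
covers each direction. If only the directions in the cone `C` are tested, the area formula for `(f -
σ) / |f - σ|` gives, up to a constant depending on `n`, `|deg_σ f| · H(C ∩ S) ≤ ∫ |Df|^(n-1) / |f -
σ|^(n-1)` over the set where `f - σ ∈ C` (`IsBrouwerDegree.mul_sphMeasure_le`). These bounds are
summed over the points of nonzero degree. There are `N ≤ D` of them, since each contributes at least
`1` to `D`. Lattice points cannot accumulate around a value of `f`, so the sum of `|f(y) - σ|^(1-n)`
is at most of order `N^(1/n) ≤ D^(1/n)` (`sum_inv_norm_sub_latticePoint_pow_le`). Hence `D · H(C ∩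
S)` is at most a constant times `D^(1/n)` times the energy over `f⁻¹(C + Σ)`, and dividing by
`D^(1/n)` finishes.

The bound for one point is first proved for a `C¹` map `w` close to `f - σ`. Its `1`-homogeneous
extension `W` satisfies `∫ χ(W) det DW = d ∫ χ` for test functions `χ` supported far from the
origin. This comes from the null Lagrangian property of the determinant and a signed count at a
regular value. Taking `χ` close to the indicator of a conical shell and using polar coordinates
gives `IsBrouwerDegree.mul_toSphere_le`. To reach Sobolev maps, `f` is averaged against a zonal
kernel. Rotation fields bound the tangential derivative of the average by the average of the weak
derivative, and Jensen's inequality with Tonelli's theorem removes the kernel.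

The argument applies to every integer `d` satisfying `IsBrouwerDegree`, so neither existence nor
uniqueness of the degree is needed. -/

open Filter Topology
set_option linter.unusedSectionVars false

/-! ### The Jacobian determinant as a null Lagrangian -/

section NullLagrangian

variable {E : Type*} [NormedAddCommGroup E] [NormedSpace ℝ E] [FiniteDimensional ℝ E]

/-- The coefficients are sums of principal minors of `A`, hence continuous. This form allows `det (1
+ t DF)` to be integrated coefficient by coefficient in `t`. -/
theorem exists_continuous_coeff_det_one_add_smul :
    ∃ e : ℕ → (E →L[ℝ] E) → ℝ, (∀ k, Continuous (e k)) ∧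
      (∀ A, e (Module.finrank ℝ E) A = A.det) ∧
      ∀ (A : E →L[ℝ] E) (t : ℝ), (1 + t • A).det =
        ∑ k ∈ Finset.range (Module.finrank ℝ E + 1), e k A * t ^ k := by
  classical
  set b := Module.finBasis ℝ E
  let M : (E →L[ℝ] E) → Matrix (Fin (Module.finrank ℝ E)) (Fin (Module.finrank ℝ E)) ℝ :=
    fun A => LinearMap.toMatrix b b (A : E →ₗ[ℝ] E)
  have hM : Continuous M := by
    refine continuous_matrix fun i j => ?_
    have : ∀ A, M A i j = b.equivFunL (A (b j)) i := by
      intro A; simp [M, LinearMap.toMatrix_apply]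
    simp only [this]
    fun_prop
  have hdet : ∀ A : E →L[ℝ] E, A.det = (M A).det := fun A => by
    simp [M, ContinuousLinearMap.det, LinearMap.det_toMatrix]
  open Polynomial in
  let P : (E →L[ℝ] E) → ℝ[X] := fun A => (1 + (X : ℝ[X]) • (M A).map C).det
  have hPdeg : ∀ A, (P A).natDegree ≤ Module.finrank ℝ E := fun A => by
    have := Polynomial.natDegree_det_X_add_C_le (M A) 1
    simpa [P, add_comm, Matrix.map_one] using this
  refine ⟨fun k A => (P A).coeff k, fun k => ?_, fun A => ?_, fun A t => ?_⟩
  · simp only [P, Matrix.coeff_det_one_add_X_smul_eq_sum_minors]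
    exact continuous_finsetSum _ fun s _ => (hM.matrix_submatrix _ _).matrix_det
  · have := Polynomial.coeff_det_X_add_C_card (M A) 1
    rw [hdet, ← this]
    simp [P, add_comm, Matrix.map_one]
  · rw [← Polynomial.eval_eq_sum_range' (Nat.lt_succ_of_le (hPdeg A)), hdet]
    have h1 : M (1 + t • A) = 1 + t • M A := by
      simp only [M]
      ext i j
      simp [LinearMap.toMatrix_apply, Matrix.one_apply, Finsupp.single_apply, eq_comm]
    rw [h1]
    simp only [P, ← Polynomial.coe_evalRingHom, RingHom.map_det]
    congr 1
    ext i j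
    rcases eq_or_ne i j with h | h <;> simp [h, mul_comm t]

variable [MeasurableSpace E] [BorelSpace E] (μ : Measure E) [μ.IsAddHaarMeasure]

theorem bijective_id_add_of_lipschitz {G : E → E} {K : NNReal} (hK : K < 1)
    (hG : LipschitzWith K G) : Function.Bijective fun x => x + G x := by
  constructor
  · intro x y hxy
    have h1 : x - y = G y - G x := by
      have : x + G x = y + G y := hxy
      rw [sub_eq_sub_iff_add_eq_add]
      rw [this, add_comm]
    have h2 : ‖x - y‖ ≤ K * ‖x - y‖ := by
      conv_lhs => rw [h1]
      simpa [dist_eq_norm, norm_sub_rev] using hG.dist_le_mul y x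
    have h3 : ‖x - y‖ = 0 := by
      have : (K : ℝ) < 1 := by exact_mod_cast hK
      nlinarith [norm_nonneg (x - y)]
    exact sub_eq_zero.mp (norm_eq_zero.mp h3)
  · intro y
    have hc : ContractingWith K fun x => y - G x := by
      refine ⟨hK, LipschitzWith.of_dist_le_mul fun a b => ?_⟩
      rw [dist_sub_left]
      exact hG.dist_le_mul a b
    refine ⟨hc.fixedPoint, ?_⟩
    have := hc.fixedPoint_isFixedPt
    unfold Function.IsFixedPt at this
    simpa using sub_eq_iff_eq_add.mp this |>.symm

/-- For small `t`, the map `x ↦ x + t F(x)` is a bijection equal to the identity off the ball, so it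
maps the ball onto itself. Its Jacobian is positive, and the change of variables formula gives the
volume. -/
theorem setIntegral_det_id_add_eq {F : E → E} (hF : ContDiff ℝ 1 F)
    {R : ℝ} (hR : ∀ x ∉ closedBall (0 : E) R, F x = 0) (hc : HasCompactSupport F) :
    ∀ᶠ t : ℝ in 𝓝 0, ∫ x in closedBall (0 : E) R, (1 + t • fderiv ℝ F x).det ∂μ =
      μ.real (closedBall (0 : E) R) := by
  have hK := (hF.lipschitzWith_of_hasCompactSupport hc (by norm_num)).choose_spec
  set K := (hF.lipschitzWith_of_hasCompactSupport hc (by norm_num)).choose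
  have hpos : ∀ᶠ B : E →L[ℝ] E in 𝓝 0, 0 < (1 + B).det := by
    have hcont : Continuous fun B : E →L[ℝ] E => (1 + B).det :=
      ContinuousLinearMap.continuous_det.comp (continuous_const.add continuous_id)
    refine hcont.continuousAt.eventually_const_lt ?_
    have : (1 + (0 : E →L[ℝ] E)).det = 1 := by
      simp [ContinuousLinearMap.det]
    simp only [this]; norm_num
  obtain ⟨δ, hδ, hδ'⟩ := Metric.eventually_nhds_iff.mp hpos
  have ht : ∀ᶠ t : ℝ in 𝓝 0, ‖t‖₊ * (K + 1) < 1 ∧ ‖t‖ * (K + 1) < δ := by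
    refine Filter.Eventually.and ?_ ?_
    · have : Continuous fun t : ℝ => ‖t‖₊ * (K + 1) := by fun_prop
      exact this.continuousAt.eventually_lt_const (by simp)
    · have : Continuous fun t : ℝ => ‖t‖ * ((K : ℝ) + 1) := by fun_prop
      exact this.continuousAt.eventually_lt_const (by simpa using hδ)
  filter_upwards [ht] with t ⟨ht1, ht2⟩
  have hLip : LipschitzWith (‖t‖₊ * K) fun x => t • F x := by
    have := (lipschitzWith_smul t).comp hK
    exact this
  have hlt : ‖t‖₊ * K < 1 := lt_of_le_of_lt (by gcongr; simp) ht1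
  have hbij := bijective_id_add_of_lipschitz hlt hLip
  have himg : (fun x => x + t • F x) '' closedBall (0 : E) R = closedBall (0 : E) R := by
    have h1 : (fun x => x + t • F x) '' (closedBall (0 : E) R)ᶜ = (closedBall (0 : E) R)ᶜ := by
      refine (image_congr (g := id) fun x hx => ?_).trans (image_id _)
      simp [hR x hx]
    rw [image_compl_eq hbij] at h1
    exact compl_injective h1
  have hder : ∀ x, HasFDerivAt (fun x => x + t • F x) (1 + t • fderiv ℝ F x) x := fun x =>
    (hasFDerivAt_id x).add
      (((hF.differentiable (by norm_num)) x).hasFDerivAt.const_smul t)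
  have hp : ∀ x, 0 < (1 + t • fderiv ℝ F x).det := fun x => by
    apply hδ'
    rw [dist_zero_right, norm_smul]
    have := norm_fderiv_le_of_lipschitz ℝ hK (x₀ := x)
    have h0 := norm_nonneg t
    nlinarith
  have key := integral_image_eq_integral_abs_det_fderiv_smul μ
    (s := closedBall (0 : E) R) measurableSet_closedBall
    (fun x _ => (hder x).hasFDerivWithinAt) hbij.1.injOn (fun _ => (1 : ℝ))
  rw [himg] at key
  simp only [smul_eq_mul, mul_one, abs_of_pos (hp _)] at key
  rw [← key]; simp [Measure.real]

/-- The Jacobian determinant of a compactly supported `C¹` map integrates to zero. -/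
theorem integral_det_fderiv_eq_zero [Nontrivial E] {F : E → E} (hF : ContDiff ℝ 1 F)
    (hc : HasCompactSupport F) : ∫ x, (fderiv ℝ F x).det ∂μ = 0 := by
  obtain ⟨e, he, htop, hsum⟩ := exists_continuous_coeff_det_one_add_smul (E := E)
  obtain ⟨R, hRsub⟩ := hc.isCompact.isBounded.subset_closedBall (0 : E)
  have hR : ∀ x ∉ closedBall (0 : E) R, F x = 0 := fun x hx =>
    image_eq_zero_of_notMem_tsupport fun h => hx (hRsub h)
  have hDF : Continuous (fderiv ℝ F) := hF.continuous_fderiv (by norm_num)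
  have hev := setIntegral_det_id_add_eq μ hF hR hc
  set d := Module.finrank ℝ E
  have hd : 0 < d := Module.finrank_pos
  -- This polynomial in `t` vanishes near `0`, hence identically. Its coefficient of degree `d > 0`,
  -- untouched by the constant term, is the integral of `det DF`.
  open Polynomial in
  let Q : ℝ[X] := ∑ k ∈ Finset.range (d + 1),
    C (∫ x in closedBall (0 : E) R, e k (fderiv ℝ F x) ∂μ) * X ^ k
      - C (μ.real (closedBall (0 : E) R))
  have hQ0 : Q = 0 := by
    refine Polynomial.eq_zero_of_infinite_isRoot _ (Set.Infinite.mono ?_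
      (infinite_of_mem_nhds (0 : ℝ) hev))
    intro t ht
    have ht' : ∫ x in closedBall (0 : E) R, (1 + t • fderiv ℝ F x).det ∂μ =
      μ.real (closedBall (0 : E) R) := ht
    simp only [Set.mem_ofPred_eq, Polynomial.IsRoot.def, Q, Polynomial.eval_sub,
      Polynomial.eval_finsetSum, Polynomial.eval_mul, Polynomial.eval_C, Polynomial.eval_pow,
      Polynomial.eval_X]
    rw [sub_eq_zero, ← ht']
    simp only [hsum]
    rw [integral_finsetSum]
    · simp only [integral_mul_const]
    · intro k _
      exact (((he k).comp hDF).continuousOn.integrableOn_compact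
        (isCompact_closedBall _ _)).mul_const _
  have hcoef : Q.coeff d = ∫ x in closedBall (0 : E) R, e d (fderiv ℝ F x) ∂μ := by
    simp [Q, Polynomial.coeff_C, hd.ne', Polynomial.coeff_X_pow]
  rw [hQ0] at hcoef
  simp only [htop, Polynomial.coeff_zero, d] at hcoef
  rw [hcoef, setIntegral_eq_integral_of_forall_compl_eq_zero]
  intro x hx
  have : fderiv ℝ F x = 0 := by
    have := support_fderiv_subset ℝ (f := F)
    by_contra h
    exact hx (hRsub (this h))
  rw [this, ContinuousLinearMap.det]
  simp

end NullLagrangian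

/-! ### The degree integral of a proper map -/

section ProperDegree

variable {E : Type*} [NormedAddCommGroup E] [NormedSpace ℝ E] [FiniteDimensional ℝ E]

theorem det_one_add_smulRight (φ : E →L[ℝ] ℝ) (a : E) :
    (1 + φ.smulRight a : E →L[ℝ] E).det = 1 + φ a := by
  rw [ContinuousLinearMap.det]
  have : ((1 + φ.smulRight a : E →L[ℝ] E) : E →ₗ[ℝ] E) =
      LinearMap.transvection (φ : E →ₗ[ℝ] ℝ) a := by
    ext x; simp [LinearMap.transvection]
  rw [this, LinearMap.transvection.det]
  rfl

theorem clm_det_comp (A B : E →L[ℝ] E) : (A ∘L B).det = A.det * B.det := by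
  simp [ContinuousLinearMap.det, LinearMap.det_comp]

theorem HasCompactSupport.comp_isProperMap {F : E → E} (hF : IsProperMap F) {χ : E → ℝ}
    (hχ : HasCompactSupport χ) : HasCompactSupport fun x => χ (F x) :=
  HasCompactSupport.of_support_subset_isCompact (hF.isCompact_preimage hχ.isCompact)
    fun _ hx => subset_tsupport χ hx

variable [MeasurableSpace E] [BorelSpace E] (μ : Measure E) [μ.IsAddHaarMeasure]

/-- The integrand is the difference of the Jacobians of `F + v(F) a` and `F`, by the rank-one
determinant formula. Neither map need have compact support, so `F` is cut off by a bump equal to `1`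
around the support of `v ∘ F`. Both Jacobians of the cut-off maps integrate to zero, and off that
support they agree. -/
theorem integral_fderiv_comp_mul_det_eq_zero [Nontrivial E] {F : E → E} (hF : ContDiff ℝ 1 F)
    {v : E → ℝ} (hv : ContDiff ℝ 1 v) (hc : HasCompactSupport fun x => v (F x)) (a : E) :
    ∫ x, fderiv ℝ v (F x) a * (fderiv ℝ F x).det ∂μ = 0 := by
  obtain ⟨R, hR⟩ := hc.isCompact.isBounded.subset_closedBall (0 : E)
  let η : ContDiffBump (0 : E) := ⟨|R| + 1, |R| + 2, by positivity, by linarith⟩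
  let G : E → E := fun x => η x • F x
  let w : E → E := fun x => v (F x) • a
  have hG : ContDiff ℝ 1 G := η.contDiff.smul hF
  have hw : ContDiff ℝ 1 w := (hv.comp hF).smul contDiff_const
  have hGc : HasCompactSupport G := η.hasCompactSupport.smul_right
  have hwc : HasCompactSupport w := hc.smul_right
  have h0 := integral_det_fderiv_eq_zero μ hG hGc
  have h1 := integral_det_fderiv_eq_zero μ (hG.add hw) (hGc.add hwc)
  have hint : ∀ H : E → E, ContDiff ℝ 1 H → HasCompactSupport H →
      Integrable (fun x => (fderiv ℝ H x).det) μ := fun H hH hHc => by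
    refine Continuous.integrable_of_hasCompactSupport
      (ContinuousLinearMap.continuous_det.comp (hH.continuous_fderiv (by norm_num))) ?_
    refine (hHc.fderiv ℝ).comp_left (g := fun A : E →L[ℝ] E => A.det) ?_
    simp [ContinuousLinearMap.det]
  rw [← sub_eq_zero.mpr (h1.trans h0.symm),
    ← integral_sub (hint _ (hG.add hw) (hGc.add hwc)) (hint _ hG hGc)]
  refine integral_congr_ae (Eventually.of_forall fun x => ?_)
  have hFx : HasFDerivAt F (fderiv ℝ F x) x := (hF.differentiable (by norm_num) x).hasFDerivAt
  have hvF : HasFDerivAt (fun x => v (F x)) (fderiv ℝ v (F x) ∘L fderiv ℝ F x) x :=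
    ((hv.differentiable (by norm_num) (F x)).hasFDerivAt).comp x hFx
  have hw' : fderiv ℝ w x = (fderiv ℝ v (F x) ∘L fderiv ℝ F x).smulRight a :=
    (hvF.smul_const a).fderiv
  have hfac : (fderiv ℝ F x + fderiv ℝ w x).det =
      (1 + fderiv ℝ v (F x) a) * (fderiv ℝ F x).det := by
    rw [← det_one_add_smulRight, ← clm_det_comp, hw']
    congr 1
  have hsum : fderiv ℝ (fun x => G x + w x) x = fderiv ℝ G x + fderiv ℝ w x :=
    fderiv_add (hG.differentiable (by norm_num) x) (hw.differentiable (by norm_num) x)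
  by_cases hx : x ∈ tsupport fun x => v (F x)
  · have hGx : fderiv ℝ G x = fderiv ℝ F x := by
      refine Filter.EventuallyEq.fderiv_eq ?_
      have hxb : x ∈ ball (0 : E) η.rIn := by
        have := hR hx
        simp only [mem_closedBall, mem_ball, dist_zero_right] at this ⊢
        change ‖x‖ < |R| + 1
        linarith [le_abs_self R]
      filter_upwards [η.eventuallyEq_one_of_mem_ball hxb] with y hy
      simp [G, hy]
    simp only [hsum, hGx, hfac]; ring
  · have h2 : fderiv ℝ v (F x) ∘L fderiv ℝ F x = 0 := by
      rw [← hvF.fderiv]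
      by_contra h
      exact hx (support_fderiv_subset ℝ h)
    have h3 : fderiv ℝ w x = 0 := by rw [hw', h2]; ext; simp
    rw [h3, add_zero] at hfac
    simp only [hsum, h3, add_zero, sub_self]
    linarith

/-- The derivative in `s` of `∫ χ(F - s a) det DF` vanishes by the previous lemma with `v = χ(· - s
a)`. It is integrated over `s ∈ [0, 1]` with Fubini's theorem. -/
theorem integral_comp_sub_mul_det_eq [Nontrivial E] {F : E → E} (hF : ContDiff ℝ 1 F)
    (hFp : IsProperMap F) {χ : E → ℝ} (hχ : ContDiff ℝ 1 χ) (hc : HasCompactSupport χ) (a : E) :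
    ∫ x, χ (F x - a) * (fderiv ℝ F x).det ∂μ = ∫ x, χ (F x) * (fderiv ℝ F x).det ∂μ := by
  -- `L` is swept out by the support of `χ` moving along `a`. Properness makes its preimage compact,
  -- which justifies Fubini.
  let L : Set E := (fun p : E × ℝ => p.1 + p.2 • a) '' (tsupport χ ×ˢ Icc (0 : ℝ) 1)
  have hL : IsCompact L := (hc.isCompact.prod isCompact_Icc).image (by fun_prop)
  have hK : IsCompact (F ⁻¹' L) := hFp.isCompact_preimage hL
  have hDF : Continuous fun x => (fderiv ℝ F x).det :=
    ContinuousLinearMap.continuous_det.comp (hF.continuous_fderiv (by norm_num))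
  have hDχ : Continuous (fderiv ℝ χ) := hχ.continuous_fderiv (by norm_num)
  have hFc := hF.continuous
  have hmem : ∀ x, ∀ s ∈ Icc (0 : ℝ) 1, F x - s • a ∈ tsupport χ → x ∈ F ⁻¹' L := fun x s hs h =>
    ⟨(F x - s • a, s), ⟨h, hs⟩, by simp⟩
  have hshift : ∀ s : ℝ, HasCompactSupport (fun y => χ (y - s • a)) := fun s =>
    hc.comp_homeomorph (Homeomorph.subRight (s • a))
  have hint : ∀ s : ℝ, Integrable (fun x => χ (F x - s • a) * (fderiv ℝ F x).det) μ := fun s =>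
    Continuous.integrable_of_hasCompactSupport
      ((hχ.continuous.comp (hFc.sub continuous_const)).mul hDF)
      (((hshift s).comp_isProperMap hFp).mul_right)
  have hint1 := hint 1
  have hint0 := hint 0
  simp only [one_smul, zero_smul, sub_zero] at hint1 hint0
  rw [← sub_eq_zero, ← integral_sub hint1 hint0]
  have hftc : ∀ x, χ (F x - a) * (fderiv ℝ F x).det - χ (F x) * (fderiv ℝ F x).det =
      - ∫ s in Icc (0 : ℝ) 1, fderiv ℝ χ (F x - s • a) a * (fderiv ℝ F x).det := fun x => by
    have hder : ∀ s : ℝ, HasDerivAt (fun s : ℝ => χ (F x - s • a))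
        (- fderiv ℝ χ (F x - s • a) a) s := fun s => by
      have h1 : HasDerivAt (fun s : ℝ => F x - s • a) (-a) s := by
        simpa using ((hasDerivAt_id s).smul_const a).const_sub (F x)
      have h2 := (hχ.differentiable (by norm_num) (F x - s • a)).hasFDerivAt.comp_hasDerivAt s h1
      simpa [Function.comp_def] using h2
    have := intervalIntegral.integral_eq_sub_of_hasDerivAt (a := 0) (b := 1)
      (fun s _ => hder s) (Continuous.intervalIntegrable (by fun_prop) _ _)
    rw [integral_mul_const, integral_Icc_eq_integral_Ioc,
      ← intervalIntegral.integral_of_le zero_le_one]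
    rw [intervalIntegral.integral_neg] at this
    simp only [one_smul, zero_smul, sub_zero] at this
    rw [← neg_mul, this]; ring
  simp only [hftc]
  rw [integral_neg, neg_eq_zero]
  have hout : ∀ x ∉ F ⁻¹' L,
      ∫ s in Icc (0 : ℝ) 1, fderiv ℝ χ (F x - s • a) a * (fderiv ℝ F x).det = 0 := fun x hx => by
    refine setIntegral_eq_zero_of_forall_eq_zero fun s hs => ?_
    have : fderiv ℝ χ (F x - s • a) = 0 := by
      by_contra h
      exact hx (hmem x s hs (support_fderiv_subset ℝ h))
    simp [this]
  rw [← setIntegral_eq_integral_of_forall_compl_eq_zero hout, integral_integral_swap]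
  · refine setIntegral_eq_zero_of_forall_eq_zero fun s hs => ?_
    rw [setIntegral_eq_integral_of_forall_compl_eq_zero]
    · have hv : ContDiff ℝ 1 fun y => χ (y - s • a) := hχ.comp (contDiff_id.sub contDiff_const)
      have := integral_fderiv_comp_mul_det_eq_zero μ hF hv ((hshift s).comp_isProperMap hFp) a
      simpa only [fderiv_comp_sub] using this
    · intro x hx
      have : fderiv ℝ χ (F x - s • a) = 0 := by
        by_contra h
        exact hx (hmem x s hs (support_fderiv_subset ℝ h))
      simp [this]
  · rw [Measure.prod_restrict]
    exact ContinuousOn.integrableOn_compact (hK.prod isCompact_Icc)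
      (((hDχ.comp ((hFc.comp continuous_fst).sub (continuous_snd.smul continuous_const))).clm_apply
        continuous_const).mul (hDF.comp continuous_fst)).continuousOn

/-- The ratio `∫ χ(F) det DF / ∫ χ` does not depend on the test function `χ`. -/
theorem integral_comp_mul_det_mul_integral [Nontrivial E] {F : E → E} (hF : ContDiff ℝ 1 F)
    (hFp : IsProperMap F) {χ ψ : E → ℝ} (hχ : ContDiff ℝ 1 χ) (hχc : HasCompactSupport χ)
    (hψ : ContDiff ℝ 1 ψ) (hψc : HasCompactSupport ψ) :
    (∫ x, χ (F x) * (fderiv ℝ F x).det ∂μ) * ∫ y, ψ y ∂μ =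
      (∫ x, ψ (F x) * (fderiv ℝ F x).det ∂μ) * ∫ y, χ y ∂μ := by
  have hDF : Continuous fun x => (fderiv ℝ F x).det :=
    ContinuousLinearMap.continuous_det.comp (hF.continuous_fderiv (by norm_num))
  have hFc := hF.continuous
  have hχ' := hχ.continuous
  have hψ' := hψ.continuous
  -- Translation invariance is averaged over `y` against the other test function. The substitution
  -- `y ↦ F x - y` then exchanges the roles of `χ` and `ψ`.
  have h1 : (∫ x, χ (F x) * (fderiv ℝ F x).det ∂μ) * ∫ y, ψ y ∂μ =
      ∫ y, ∫ x, χ (F x - y) * (fderiv ℝ F x).det * ψ y ∂μ ∂μ := by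
    rw [← integral_const_mul]
    refine integral_congr_ae (Eventually.of_forall fun y => ?_)
    simp only
    rw [integral_mul_const, integral_comp_sub_mul_det_eq μ hF hFp hχ hχc y]
  have h2 : (∫ x, ψ (F x) * (fderiv ℝ F x).det ∂μ) * ∫ y, χ y ∂μ =
      ∫ y, ∫ x, ψ (F x - y) * (fderiv ℝ F x).det * χ y ∂μ ∂μ := by
    rw [← integral_const_mul]
    refine integral_congr_ae (Eventually.of_forall fun y => ?_)
    simp only
    rw [integral_mul_const, integral_comp_sub_mul_det_eq μ hF hFp hψ hψc y]
  have hcs : ∀ φ θ : E → ℝ, HasCompactSupport φ → HasCompactSupport θ →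
      HasCompactSupport (Function.uncurry fun y x : E =>
        φ (F x - y) * (fderiv ℝ F x).det * θ y) := fun φ θ hφ hθ => by
    refine HasCompactSupport.of_support_subset_isCompact
      (hθ.isCompact.prod (hFp.isCompact_preimage (hφ.isCompact.add hθ.isCompact))) ?_
    rintro ⟨y, x⟩ hyx
    simp only [Function.mem_support, Function.uncurry_apply_pair, ne_eq, mul_eq_zero, not_or] at hyx
    exact ⟨subset_tsupport θ hyx.2,
      ⟨F x - y, subset_tsupport φ hyx.1.1, y, subset_tsupport θ hyx.2, by simp⟩⟩
  have hcont : ∀ φ θ : E → ℝ, Continuous φ → Continuous θ →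
      Continuous (Function.uncurry fun y x : E =>
        φ (F x - y) * (fderiv ℝ F x).det * θ y) := fun φ θ hφ hθ =>
    ((hφ.comp ((hFc.comp continuous_snd).sub continuous_fst)).mul
      (hDF.comp continuous_snd)).mul (hθ.comp continuous_fst)
  rw [h1, h2, integral_integral_swap_of_hasCompactSupport (hcont χ ψ hχ' hψ') (hcs χ ψ hχc hψc),
    integral_integral_swap_of_hasCompactSupport (hcont ψ χ hψ' hχ') (hcs ψ χ hψc hχc)]
  refine integral_congr_ae (Eventually.of_forall fun x => ?_)
  simp only
  rw [← integral_sub_left_eq_self (fun y => χ (F x - y) * (fderiv ℝ F x).det * ψ y) μ (F x)]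
  refine integral_congr_ae (Eventually.of_forall fun y => ?_)
  simp only [sub_sub_cancel]
  ring

end ProperDegree

/-! ### Signed count of preimages at a regular value -/

section RegularValue

variable {E : Type*} [NormedAddCommGroup E] [NormedSpace ℝ E] [FiniteDimensional ℝ E]

theorem exists_injOn_nhds_of_det_ne_zero {F : E → E} (hF : ContDiff ℝ 1 F) {x : E}
    (hx : (fderiv ℝ F x).det ≠ 0) : (∃ s ∈ 𝓝 x, InjOn F s) ∧ map F (𝓝 x) = 𝓝 (F x) := by
  let A := ContinuousLinearMap.toContinuousLinearEquivOfDetNeZero (fderiv ℝ F x) hx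
  have hA : (A : E →L[ℝ] E) = fderiv ℝ F x := by ext; simp [A]
  have hs : HasStrictFDerivAt F (A : E →L[ℝ] E) x := by
    rw [hA]; exact hF.contDiffAt.hasStrictFDerivAt (by norm_num)
  refine ⟨⟨(hs.toOpenPartialHomeomorph F).source,
    (hs.toOpenPartialHomeomorph F).open_source.mem_nhds
      hs.mem_toOpenPartialHomeomorph_source, ?_⟩, hs.map_nhds_eq_of_equiv⟩
  simpa using (hs.toOpenPartialHomeomorph F).injOn

variable [MeasurableSpace E] [BorelSpace E] (μ : Measure E) [μ.IsAddHaarMeasure]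

/-- Near a regular value, the degree integral counts preimages with sign. -/
theorem exists_bump_integral_comp_mul_det {F : E → E} (hF : ContDiff ℝ 1 F)
    (hFp : IsProperMap F) {y : E} {P : Finset E} (hP : ∀ x, x ∈ P ↔ F x = y)
    (hreg : ∀ x ∈ P, (fderiv ℝ F x).det ≠ 0) :
    ∃ χ : E → ℝ, ContDiff ℝ 1 χ ∧ HasCompactSupport χ ∧ 0 < ∫ z, χ z ∂μ ∧
      ∫ x, χ (F x) * (fderiv ℝ F x).det ∂μ =
        (∑ x ∈ P, (SignType.sign (fderiv ℝ F x).det : ℝ)) * ∫ z, χ z ∂μ := by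
  have hDF : Continuous fun x => (fderiv ℝ F x).det :=
    ContinuousLinearMap.continuous_det.comp (hF.continuous_fderiv (by norm_num))
  obtain ⟨V, hV, hVdisj⟩ := P.finite_toSet.t2_separation
  have hU : ∀ x ∈ P, ∃ U : Set E, IsOpen U ∧ x ∈ U ∧ U ⊆ V x ∧ InjOn F U ∧
      (∀ z ∈ U, 0 < (fderiv ℝ F z).det * (fderiv ℝ F x).det) ∧ F '' U ∈ 𝓝 y := fun x hx => by
    obtain ⟨⟨s, hs, hinj⟩, hmap⟩ := exists_injOn_nhds_of_det_ne_zero hF (hreg x hx)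
    have h1 : ∀ᶠ z in 𝓝 x, 0 < (fderiv ℝ F z).det * (fderiv ℝ F x).det :=
      (hDF.mul continuous_const).continuousAt.eventually_const_lt
        (mul_self_pos.mpr (hreg x hx))
    have h2 : V x ∩ s ∩ {z | 0 < (fderiv ℝ F z).det * (fderiv ℝ F x).det} ∈ 𝓝 x :=
      inter_mem (inter_mem ((hV x).2.mem_nhds (hV x).1) hs) h1
    obtain ⟨U, hUsub, hUo, hxU⟩ := _root_.mem_nhds_iff.mp h2
    refine ⟨U, hUo, hxU, fun z hz => (hUsub hz).1.1, hinj.mono fun z hz => (hUsub hz).1.2,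
      fun z hz => (hUsub hz).2, ?_⟩
    rw [← (hP x).mp hx, ← hmap]
    exact image_mem_map (hUo.mem_nhds hxU)
  choose! U hUo hxU hUV hUinj hUsign hUimg using hU
  -- A proper map is closed, so a small ball around `y` misses the image of everything outside the
  -- sets `U x`.
  have hclosed : IsClosed (F '' (⋃ x ∈ P, U x)ᶜ) :=
    hFp.isClosedMap _ (isOpen_biUnion fun x hx => hUo x hx).isClosed_compl
  have hy : y ∉ F '' (⋃ x ∈ P, U x)ᶜ := by
    rintro ⟨x, hx, hxy⟩
    exact hx (mem_biUnion ((hP x).mpr hxy) (hxU x ((hP x).mpr hxy)))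
  have hN : (⋂ x ∈ P, F '' U x) ∩ (F '' (⋃ x ∈ P, U x)ᶜ)ᶜ ∈ 𝓝 y :=
    inter_mem ((Filter.biInter_finset_mem P).mpr hUimg) (hclosed.isOpen_compl.mem_nhds hy)
  obtain ⟨ε, hε, hεN⟩ := Metric.mem_nhds_iff.mp hN
  let χ : ContDiffBump y := ⟨ε / 2, ε, by positivity, by linarith⟩
  have hχN : ∀ z, χ z ≠ 0 → z ∈ (⋂ x ∈ P, F '' U x) ∩ (F '' (⋃ x ∈ P, U x)ᶜ)ᶜ := fun z hz => by
    refine hεN ?_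
    have : z ∈ Function.support χ := hz
    rwa [χ.support_eq] at this
  refine ⟨χ, χ.contDiff, χ.hasCompactSupport, χ.integral_pos, ?_⟩
  have hint : Integrable (fun x => χ (F x) * (fderiv ℝ F x).det) μ :=
    ((χ.continuous.comp hF.continuous).mul hDF).integrable_of_hasCompactSupport
      ((χ.hasCompactSupport.comp_isProperMap hFp).mul_right)
  have hout : ∀ x ∉ ⋃ x ∈ P, U x, χ (F x) * (fderiv ℝ F x).det = 0 := fun x hx => by
    by_contra h
    exact (hχN _ (left_ne_zero_of_mul h)).2 ⟨x, hx, rfl⟩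
  rw [← setIntegral_eq_integral_of_forall_compl_eq_zero hout,
    integral_biUnion_finset P (fun x hx => (hUo x hx).measurableSet)
      (fun a ha b hb hab => (hVdisj ha hb hab).mono (hUV a ha) (hUV b hb))
      (fun x _ => hint.integrableOn), Finset.sum_mul]
  refine Finset.sum_congr rfl fun x hx => ?_
  -- The Jacobian keeps its sign on `U x`, where `F` is injective, so the change of variables gives
  -- this sign times `∫ χ`.
  have hsgn : ∀ z ∈ U x, χ (F z) * (fderiv ℝ F z).det =
      (SignType.sign (fderiv ℝ F x).det : ℝ) * (|(fderiv ℝ F z).det| • χ (F z)) := fun z hz => by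
    have := hUsign x hx z hz
    rcases mul_pos_iff.mp this with ⟨h1, h2⟩ | ⟨h1, h2⟩
    · simp [sign_pos h2, abs_of_pos h1, mul_comm]
    · simp [sign_neg h2, abs_of_neg h1, mul_comm]
  rw [setIntegral_congr_fun (hUo x hx).measurableSet hsgn, integral_const_mul,
    ← integral_image_eq_integral_abs_det_fderiv_smul μ (hUo x hx).measurableSet
      (fun z _ => (hF.differentiable (by norm_num) z).hasFDerivAt.hasFDerivWithinAt) (hUinj x hx) χ,
    setIntegral_eq_integral_of_forall_compl_eq_zero]
  intro z hz
  by_contra h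
  exact hz (mem_iInter₂.mp (hχN z h).1 x hx)

/-- For a proper `C¹` map with a regular value, `∫ χ(F) det DF` is the signed count of preimages
times `∫ χ`, for every test function `χ`. -/
theorem integral_comp_mul_det_eq_sum_sign [Nontrivial E] {F : E → E} (hF : ContDiff ℝ 1 F)
    (hFp : IsProperMap F) {y : E} {P : Finset E} (hP : ∀ x, x ∈ P ↔ F x = y)
    (hreg : ∀ x ∈ P, (fderiv ℝ F x).det ≠ 0) {χ : E → ℝ} (hχ : ContDiff ℝ 1 χ)
    (hχc : HasCompactSupport χ) :
    ∫ x, χ (F x) * (fderiv ℝ F x).det ∂μ =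
      (∑ x ∈ P, (SignType.sign (fderiv ℝ F x).det : ℝ)) * ∫ z, χ z ∂μ := by
  obtain ⟨ψ, hψ, hψc, hpos, hψi⟩ := exists_bump_integral_comp_mul_det μ hF hFp hP hreg
  have := integral_comp_mul_det_mul_integral μ hF hFp hχ hχc hψ hψc
  rw [hψi] at this
  refine mul_right_cancel₀ hpos.ne' (this.trans ?_)
  ring

end RegularValue

/-! ### From maps of spheres to proper maps of the whole space -/

section ConicExtension

variable {n : ℕ}

open Classical in
/-- The extension `x ↦ |x| h(|x|, x/|x|)` to `ℝⁿ` of a family of maps `h(t, ·)` on the sphere. -/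
noncomputable def conicExt (h : ℝ → Sph n → Euc n) (x : Euc n) : Euc n :=
  if hx : x = 0 then 0 else ‖x‖ • h ‖x‖ ⟨‖x‖⁻¹ • x, normalize_mem_sphere hx⟩

theorem conicExt_of_ne {h : ℝ → Sph n → Euc n} {x : Euc n} (hx : x ≠ 0) :
    conicExt h x = ‖x‖ • h ‖x‖ ⟨‖x‖⁻¹ • x, normalize_mem_sphere hx⟩ := by
  simp [conicExt, hx]

theorem homExt_of_ne {g : C(Sph n, Sph n)} {x : Euc n} (hx : x ≠ 0) :
    homExt g x = ‖x‖ • (g ⟨‖x‖⁻¹ • x, normalize_mem_sphere hx⟩ : Euc n) := by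
  simp [homExt, hx]

theorem homExt_coe (g : C(Sph n, Sph n)) (x : Sph n) : homExt g x = g x := by
  have hx : ‖(x : Euc n)‖ = 1 := mem_sphere_zero_iff_norm.mp x.2
  have hx0 : (x : Euc n) ≠ 0 := by rw [← norm_ne_zero_iff, hx]; norm_num
  rw [homExt_of_ne hx0]
  simp [hx]

theorem continuous_conicExt {h : ℝ → Sph n → Euc n}
    (hc : Continuous fun p : ℝ × Sph n => h p.1 p.2) {r : ℝ} (hr : 0 < r)
    (h0 : ∀ t ≤ r, ∀ u, h t u = 0) : Continuous (conicExt h) := by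
  rw [continuous_iff_continuousAt]
  intro x
  by_cases hx : x = 0
  · have : conicExt h =ᶠ[𝓝 x] fun _ => 0 := by
      rw [hx]
      filter_upwards [ball_mem_nhds (0 : Euc n) hr] with z hz
      by_cases hz0 : z = 0
      · simp [conicExt, hz0]
      · rw [conicExt_of_ne hz0, h0 _ (mem_ball_zero_iff.mp hz).le, smul_zero]
    exact continuousAt_const.congr this.symm
  · have hco : ContinuousOn (conicExt h) {0}ᶜ := by
      rw [continuousOn_iff_continuous_domRestrict]
      have : ({0}ᶜ : Set (Euc n)).domRestrict (conicExt h) = fun z : ({0}ᶜ : Set (Euc n)) =>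
          ‖(z : Euc n)‖ • h ‖(z : Euc n)‖ ⟨‖(z : Euc n)‖⁻¹ • (z : Euc n),
            normalize_mem_sphere z.2⟩ := by
        ext1 z; exact conicExt_of_ne z.2
      rw [this]
      have hn : Continuous fun z : ({0}ᶜ : Set (Euc n)) => ‖(z : Euc n)‖ := by fun_prop
      refine hn.smul (hc.comp (hn.prodMk (Continuous.subtype_mk ?_ _)))
      exact (hn.inv₀ fun z => norm_ne_zero_iff.mpr z.2).smul continuous_subtype_val
    exact hco.continuousAt (isOpen_compl_singleton.mem_nhds hx)

/-- The `1`-homogeneous extension of the restriction of `w` to the sphere. -/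
noncomputable def radialExt (w : Euc n → Euc n) (x : Euc n) : Euc n := ‖x‖ • w (‖x‖⁻¹ • x)

theorem contDiffOn_radialExt {w : Euc n → Euc n} (hw : ContDiff ℝ 1 w) :
    ContDiffOn ℝ 1 (radialExt w) {0}ᶜ := by
  have hn : ContDiffOn ℝ 1 (fun x : Euc n => ‖x‖) {0}ᶜ := fun x hx =>
    (contDiffAt_norm ℝ hx).contDiffWithinAt
  exact hn.smul (hw.comp_contDiffOn
    ((hn.inv fun x hx => norm_ne_zero_iff.mpr hx).smul contDiffOn_id))

/-- The degree of `g` is computed by the Jacobian of the `1`-homogeneous extension of any map to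
`ℝⁿ \ {0}` homotopic to `g`, tested against functions supported far away from the origin. -/
theorem exists_radius_integral_radialExt (hn : 1 ≤ n) {g : C(Sph n, Sph n)}
    (hg : ContDiffOn ℝ 1 (homExt g) {0}ᶜ) {y : Sph n} {P : Finset (Sph n)}
    (hP : ∀ x, x ∈ P ↔ g x = y) (hreg : ∀ x ∈ P, sphereJac g x ≠ 0)
    {w : Euc n → Euc n} (hw : ContDiff ℝ 1 w) {h : ℝ → Sph n → Euc n}
    (hc : Continuous fun p : ℝ × Sph n => h p.1 p.2) {c C : ℝ} (hcpos : 0 < c)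
    (hlow : ∀ t u, c ≤ ‖h t u‖) (hup : ∀ t u, ‖h t u‖ ≤ C)
    (hh0 : ∀ t ≤ 0, ∀ u, h t u = g u) (hh1 : ∀ t, 1 ≤ t → ∀ u : Sph n, h t u = w u) :
    ∃ R : ℝ, ∀ χ : Euc n → ℝ, ContDiff ℝ 1 χ → HasCompactSupport χ →
      (∀ z, ‖z‖ ≤ R → χ z = 0) →
      ∫ x, χ (radialExt w x) * (fderiv ℝ (radialExt w) x).det =
        (∑ x ∈ P, (SignType.sign (sphereJac g x) : ℝ)) * ∫ z, χ z := by
  have : Nonempty (Fin n) := ⟨⟨0, hn⟩⟩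
  have hnt : Nontrivial (Euc n) := inferInstance
  -- The choice gives `T - 1 ≥ 2` and `c T ≥ 2`. Thus `|F₀| ≥ 2` for `|x| > T - 1`, and no value of
  -- norm `1` is taken there even after an error `1/4`.
  set T : ℝ := 3 + 2 / c with hT
  have hT3 : 3 ≤ T := by rw [hT]; have : 0 < 2 / c := by positivity
                         linarith
  have hcT : 2 ≤ c * T := by
    rw [hT, mul_add, mul_div_cancel₀ _ hcpos.ne']; nlinarith
  -- This cutoff removes the singularity of the homogeneous extension at the origin without
  -- affecting a neighbourhood of the unit sphere.
  let s : ℝ → ℝ := fun t => Real.smoothTransition (4 * t - 1)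
  have hs0 : ∀ t ≤ 1 / 4, s t = 0 := fun t ht =>
    Real.smoothTransition.zero_of_nonpos (by linarith)
  have hs1 : ∀ t, 1 / 2 ≤ t → s t = 1 := fun t ht =>
    Real.smoothTransition.one_of_one_le (by linarith)
  have hsc : ContDiff ℝ 1 s :=
    Real.smoothTransition.contDiff.comp ((contDiff_const.mul contDiff_id).sub contDiff_const)
  -- The homotopy runs along the radius: `F₀` is the cut-off extension of `g` for `|x| ≤ T` and the
  -- extension of `w` for `|x| ≥ T + 1`.
  let F₀ : Euc n → Euc n := conicExt fun t u => s t • h (t - T) u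
  have hF₀c : Continuous F₀ := by
    refine continuous_conicExt ?_ (r := 1 / 4) (by norm_num) fun t ht u => by simp [hs0 t ht]
    exact (hsc.continuous.comp continuous_fst).smul
      (hc.comp ((continuous_fst.sub continuous_const).prodMk continuous_snd))
  have hF₀g : ∀ x, ‖x‖ ≤ T → F₀ x = s ‖x‖ • homExt g x := fun x hx => by
    by_cases hx0 : x = 0
    · simp [F₀, conicExt, homExt, hx0]
    · simp only [F₀]
      rw [conicExt_of_ne hx0, homExt_of_ne hx0, hh0 _ (by linarith), smul_comm]
  have hF₀w : ∀ x, T + 1 ≤ ‖x‖ → F₀ x = radialExt w x := fun x hx => by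
    have hx0 : x ≠ 0 := by rw [← norm_pos_iff]; linarith
    simp only [F₀]
    rw [conicExt_of_ne hx0, hh1 _ (by linarith), hs1 _ (by linarith), one_smul]
    rfl
  have hF₀low : ∀ x, 1 / 2 ≤ ‖x‖ → c * ‖x‖ ≤ ‖F₀ x‖ := fun x hx => by
    have hx0 : x ≠ 0 := by rw [← norm_pos_iff]; linarith
    simp only [F₀]
    rw [conicExt_of_ne hx0, hs1 _ hx, one_smul, norm_smul, norm_norm, mul_comm c]
    gcongr
    exact hlow _ _
  have hsmooth : ContDiffOn ℝ 1 F₀ ({x | ‖x‖ < T} ∪ {x | T + 1 < ‖x‖}) := by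
    have ho1 : IsOpen {x : Euc n | ‖x‖ < T} := isOpen_lt continuous_norm continuous_const
    have ho2 : IsOpen {x : Euc n | T + 1 < ‖x‖} := isOpen_lt continuous_const continuous_norm
    intro x hx
    apply ContDiffAt.contDiffWithinAt
    rcases hx with hx | hx
    · have he : F₀ =ᶠ[𝓝 x] fun x => s ‖x‖ • homExt g x := by
        filter_upwards [ho1.mem_nhds hx] with z hz using hF₀g z (le_of_lt hz)
      by_cases hx0 : x = 0
      · have : F₀ =ᶠ[𝓝 x] fun _ => 0 := by
          rw [hx0] at he ⊢
          filter_upwards [he, ball_mem_nhds (0 : Euc n) (show (0 : ℝ) < 1 / 4 by norm_num)]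
            with z hz hz'
          rw [hz, hs0 _ (mem_ball_zero_iff.mp hz').le, zero_smul]
        exact contDiffAt_const.congr_of_eventuallyEq this
      · refine ContDiffAt.congr_of_eventuallyEq ?_ he
        exact (hsc.contDiffAt.comp x (contDiffAt_norm ℝ hx0)).smul
          (hg.contDiffAt (isOpen_compl_singleton.mem_nhds hx0))
    · have he : F₀ =ᶠ[𝓝 x] radialExt w := by
        filter_upwards [ho2.mem_nhds hx] with z hz using hF₀w z (le_of_lt hz)
      have hx0 : x ≠ 0 := by
        rw [← norm_pos_iff]; have : T + 1 < ‖x‖ := hx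
        linarith
      exact ((contDiffOn_radialExt hw).contDiffAt
        (isOpen_compl_singleton.mem_nhds hx0)).congr_of_eventuallyEq he
  -- In the transition shell `F₀` is only known to be continuous. It is replaced by a `C¹` map
  -- within `1/4`, unchanged for `|x| ≤ T - 1` and `|x| ≥ T + 2`.
  obtain ⟨F, hF, hFapp, hFeq, -⟩ := hF₀c.exists_contDiff_approx_and_eqOn (n := 1)
    (ε := fun _ => 1 / 4) continuous_const (fun _ => by norm_num)
    (S := {x | ‖x‖ ≤ T - 1} ∪ {x | T + 2 ≤ ‖x‖})
    (U := {x | ‖x‖ < T} ∪ {x | T + 1 < ‖x‖})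
    ((isClosed_le continuous_norm continuous_const).union
      (isClosed_le continuous_const continuous_norm))
    (by
      refine IsOpen.mem_nhdsSet ((isOpen_lt continuous_norm continuous_const).union
        (isOpen_lt continuous_const continuous_norm)) |>.mpr ?_
      rintro x (hx | hx)
      · left; have : ‖x‖ ≤ T - 1 := hx
        change ‖x‖ < T; linarith
      · right; have : T + 2 ≤ ‖x‖ := hx
        change T + 1 < ‖x‖; linarith)
    hsmooth
  have hF1 : ContDiff ℝ 1 F := hF
  have hFnorm : ∀ x, ‖F₀ x‖ - 1 / 4 ≤ ‖F x‖ := fun x => by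
    have h1 := hFapp x
    rw [dist_eq_norm] at h1
    have h2 := norm_sub_norm_le (F₀ x) (F x)
    rw [norm_sub_rev] at h2
    linarith
  have hFp : IsProperMap F := by
    rw [isProperMap_iff_tendsto_cocompact]
    refine ⟨hF1.continuous, Filter.tendsto_cocompact_cocompact_of_norm fun b => ?_⟩
    refine ⟨max 1 ((b + 1) / c), fun x hx => ?_⟩
    have h1 := hF₀low x (by linarith [le_max_left 1 ((b + 1) / c)])
    have h2 := (div_lt_iff₀' hcpos).mp ((le_max_right _ _).trans_lt hx)
    linarith [hFnorm x]
  -- Inside radius `T - 1`, `F x = y` forces `s(|x|) |x| = 1`, hence `|x| = 1`. Farther out `|F| >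
  -- 1`.
  have hPF : ∀ x, x ∈ P.map ⟨Subtype.val, Subtype.val_injective⟩ ↔ F x = y := fun x => by
    have hy : ‖(y : Euc n)‖ = 1 := mem_sphere_zero_iff_norm.mp y.2
    simp only [Finset.mem_map, Function.Embedding.coeFn_mk]
    constructor
    · rintro ⟨u, hu, rfl⟩
      have hu1 : ‖(u : Euc n)‖ = 1 := mem_sphere_zero_iff_norm.mp u.2
      rw [hFeq (Or.inl (by change ‖(u : Euc n)‖ ≤ T - 1; linarith)), hF₀g _ (by linarith),
        homExt_coe, hu1, hs1 _ (by norm_num), one_smul, (hP u).mp hu]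
    · intro hx
      by_cases hxT : ‖x‖ ≤ T - 1
      · rw [hFeq (Or.inl hxT), hF₀g _ (by linarith)] at hx
        have hx0 : x ≠ 0 := by
          rintro rfl
          rw [← hx] at hy
          simp [homExt] at hy
        rw [homExt_of_ne hx0] at hx
        have hgn : ‖(g ⟨‖x‖⁻¹ • x, normalize_mem_sphere hx0⟩ : Euc n)‖ = 1 :=
          mem_sphere_zero_iff_norm.mp (g _).2
        have hnorm : s ‖x‖ * ‖x‖ = 1 := by
          rw [← hy, ← hx, norm_smul, norm_smul, hgn, norm_norm, mul_one,
            Real.norm_of_nonneg (Real.smoothTransition.nonneg _)]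
        have hsle : s ‖x‖ ≤ 1 := Real.smoothTransition.le_one _
        have hge : 1 ≤ ‖x‖ := by nlinarith [norm_nonneg x]
        have hs' := hs1 ‖x‖ (by linarith)
        rw [hs', one_mul] at hnorm
        refine ⟨⟨x, mem_sphere_zero_iff_norm.mpr hnorm⟩, (hP _).mpr ?_, rfl⟩
        apply Subtype.ext
        rw [← hx, hs', one_smul]
        simp [hnorm]
      · exfalso
        push Not at hxT
        have h1 := hFnorm x
        rw [hx, hy] at h1
        rcases le_or_gt ‖x‖ T with h2 | h2
        · rw [hF₀g _ h2, hs1 _ (by linarith), one_smul,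
            homExt_of_ne (by rw [← norm_pos_iff]; linarith), norm_smul,
            mem_sphere_zero_iff_norm.mp (g _).2, norm_norm] at h1
          linarith
        · have h3 := hF₀low x (by linarith)
          nlinarith
  have hder : ∀ x ∈ P, fderiv ℝ F (x : Euc n) = fderiv ℝ (homExt g) x := fun x _ => by
    refine Filter.EventuallyEq.fderiv_eq ?_
    have hx1 : ‖(x : Euc n)‖ = 1 := mem_sphere_zero_iff_norm.mp x.2
    have h1 : ∀ᶠ z : Euc n in 𝓝 x, 1 / 2 < ‖z‖ :=
      continuous_norm.continuousAt.eventually_const_lt (by simp only [hx1]; norm_num)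
    have h2 : ∀ᶠ z : Euc n in 𝓝 x, ‖z‖ < T - 1 :=
      continuous_norm.continuousAt.eventually_lt_const (by simp only [hx1]; linarith)
    filter_upwards [h1, h2] with z hz1 hz2
    rw [hFeq (Or.inl hz2.le), hF₀g _ (by linarith), hs1 _ hz1.le, one_smul]
  obtain ⟨R, hR⟩ := ((isCompact_closedBall (0 : Euc n) (T + 2)).image
    hF1.continuous).isBounded.exists_norm_le
  have hC : 0 ≤ C := by
    obtain ⟨u⟩ : Nonempty (Sph n) := (NormedSpace.sphere_nonempty.mpr zero_le_one).to_subtype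
    exact (norm_nonneg _).trans (hup 0 u)
  -- `F` and the extension of `w` agree beyond radius `T + 2`. Within it, `R` bounds the first and
  -- `(T + 2) C` the second, so `χ` vanishes on both.
  refine ⟨max R ((T + 2) * C), fun χ hχ hχc hχ0 => ?_⟩
  have key := integral_comp_mul_det_eq_sum_sign volume hF1 hFp hPF
    (by
      intro x hx
      simp only [Finset.mem_map, Function.Embedding.coeFn_mk] at hx
      obtain ⟨u, hu, rfl⟩ := hx
      rw [hder u hu]; exact hreg u hu) hχ hχc
  rw [Finset.sum_map] at key
  have hsum : ∑ x ∈ P, (SignType.sign (fderiv ℝ F (x : Euc n)).det : ℝ) =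
      ∑ x ∈ P, (SignType.sign (sphereJac g x) : ℝ) :=
    Finset.sum_congr rfl fun x hx => by rw [hder x hx]; rfl
  simp only [Function.Embedding.coeFn_mk] at key
  rw [hsum] at key
  rw [← key]
  refine integral_congr_ae (Eventually.of_forall fun x => ?_)
  simp only
  rcases le_or_gt ‖x‖ (T + 2) with hx | hx
  · rw [hχ0 (F x), hχ0 (radialExt w x)]
    · simp
    · by_cases hx0 : x = 0
      · simp only [radialExt, hx0, norm_zero, zero_smul]
        exact le_max_of_le_right (by positivity)
      · refine le_max_of_le_right ?_
        rw [radialExt, norm_smul, norm_norm]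
        refine mul_le_mul hx ?_ (norm_nonneg _) (by linarith)
        have := hup 1 ⟨‖x‖⁻¹ • x, normalize_mem_sphere hx0⟩
        rwa [hh1 1 le_rfl] at this
    · exact le_max_of_le_left (hR _ ⟨x, by simpa using hx, rfl⟩)
  · have he : F =ᶠ[𝓝 x] radialExt w := by
      filter_upwards [(isOpen_lt continuous_const continuous_norm).mem_nhds hx] with z hz
      have hz' : T + 2 < ‖z‖ := hz
      rw [hFeq (Or.inr hz'.le), hF₀w z (by linarith)]
    rw [he.fderiv_eq, he.eq_of_nhds]

end ConicExtension

/-! ### The degree formula for maps close to `f - p` -/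

section DegreeIntegral

variable {n : ℕ}

theorem inner_pos_of_norm_sub_lt {F : Type*} [NormedAddCommGroup F] [InnerProductSpace ℝ F]
    {w v : F} (h : ‖w - v‖ < ‖v‖) : 0 < inner ℝ w v := by
  have h1 := norm_sub_sq_real w v
  have h2 : ‖w - v‖ ^ 2 < ‖v‖ ^ 2 := by gcongr
  nlinarith [sq_nonneg ‖w‖]

/-- Since `⟨w, f - p⟩ > 0`, the segment from `(f - p) / |f - p|` to `w` avoids the origin. Together
with the homotopy to a smooth representative this is a homotopy through nonzero vectors, and
compactness supplies the bounds `c` and `C`. -/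
theorem IsBrouwerDegree.exists_radius_integral_radialExt (hn : 1 ≤ n) {f : C(Sph n, Euc n)}
    {p : Euc n} {hp : ∀ x, f x ≠ p} {d : ℤ} (hd : IsBrouwerDegree (normalizedMap f p hp) d)
    {w : Euc n → Euc n} (hw : ContDiff ℝ 1 w)
    (hwf : ∀ x : Sph n, ‖w x - (f x - p)‖ < ‖f x - p‖) :
    ∃ R : ℝ, ∀ χ : Euc n → ℝ, ContDiff ℝ 1 χ → HasCompactSupport χ →
      (∀ z, ‖z‖ ≤ R → χ z = 0) →
      ∫ x, χ (radialExt w x) * (fderiv ℝ (radialExt w) x).det = (d : ℝ) * ∫ z, χ z := by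
  obtain ⟨g, hfg, hg, y, P, hP, hreg, rfl⟩ := hd
  have : Nonempty (Fin n) := ⟨⟨0, hn⟩⟩
  let Y := {v : Euc n // v ≠ 0}
  let ι : C(Sph n, Y) :=
    ⟨fun u => ⟨u, norm_ne_zero_iff.mp (by simp)⟩,
      continuous_subtype_val.subtype_mk _⟩
  have hw0 : ∀ x : Sph n, 0 < inner ℝ (w x) (f x - p) := fun x => inner_pos_of_norm_sub_lt (hwf x)
  have hwne : ∀ x : Sph n, w x ≠ 0 := fun x h0 => by
    have := hw0 x
    simp [h0] at this
  let wS : C(Sph n, Y) := ⟨fun x => ⟨w x, hwne x⟩,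
    (hw.continuous.comp continuous_subtype_val).subtype_mk _⟩
  have hlin : (ι.comp (normalizedMap f p hp)).Homotopic wS := by
    refine ⟨⟨⟨fun q => ⟨(1 - (q.1 : ℝ)) • (normalizedMap f p hp q.2 : Euc n) + (q.1 : ℝ) • w q.2,
      fun h0 => ?_⟩, ?_⟩, fun x => ?_, fun x => ?_⟩⟩
    · have h1 := congrArg (fun v => inner ℝ v (f q.2 - p)) h0
      simp only [inner_add_left, inner_smul_left, normalizedMap, ContinuousMap.coe_mk,
        real_inner_self_eq_norm_sq, inner_zero_left, RCLike.conj_to_real] at h1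
      have h2 : 0 < ‖f q.2 - p‖ := norm_pos_iff.mpr (sub_ne_zero.mpr (hp q.2))
      have h3 : ‖f q.2 - p‖⁻¹ * ‖f q.2 - p‖ ^ 2 = ‖f q.2 - p‖ := by field_simp
      rw [h3] at h1
      have h4 := hw0 q.2
      have h5 := q.1.2.1
      have h6 := q.1.2.2
      rcases h5.eq_or_lt with h7 | h7
      · rw [← h7] at h1; linarith
      · have := mul_pos h7 h4
        have := mul_nonneg (sub_nonneg.mpr h6) h2.le
        linarith
    · refine Continuous.subtype_mk ?_ _
      have h1 : Continuous fun q : unitInterval × Sph n => (normalizedMap f p hp q.2 : Euc n) :=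
        continuous_subtype_val.comp ((normalizedMap f p hp).continuous.comp continuous_snd)
      have h2 : Continuous fun q : unitInterval × Sph n => w q.2 :=
        hw.continuous.comp (continuous_subtype_val.comp continuous_snd)
      fun_prop
    · apply Subtype.ext; simp [ι]
    · apply Subtype.ext; simp [wS]
  obtain ⟨H⟩ := ((ContinuousMap.Homotopic.refl ι).comp hfg.symm).trans hlin
  have hnt : Nonempty (Sph n) := (NormedSpace.sphere_nonempty.mpr zero_le_one).to_subtype
  have hcn : Continuous fun q : unitInterval × Sph n => ‖(H q : Euc n)‖ :=
    (continuous_subtype_val.comp H.continuous).norm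
  obtain ⟨q₀, -, hq₀⟩ := isCompact_univ.exists_isMinOn univ_nonempty hcn.continuousOn
  obtain ⟨q₁, -, hq₁⟩ := isCompact_univ.exists_isMaxOn univ_nonempty hcn.continuousOn
  rw [isMinOn_univ_iff] at hq₀
  rw [isMaxOn_univ_iff] at hq₁
  refine _root_.exists_radius_integral_radialExt hn (hg.of_le (by norm_num)) hP hreg hw
    (h := fun t u => (H.extend t u : Euc n))
    (c := ‖(H q₀ : Euc n)‖) (C := ‖(H q₁ : Euc n)‖) ?_ (norm_pos_iff.mpr (H q₀).2)
    (fun t u => hq₀ (projIcc 0 1 zero_le_one t, u)) (fun t u => hq₁ (projIcc 0 1 zero_le_one t, u))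
    (fun t ht u => ?_) (fun t ht u => ?_) |>.imp fun R hR χ h1 h2 h3 => ?_
  · refine continuous_subtype_val.comp ?_
    exact H.continuous.comp ((continuous_projIcc.comp continuous_fst).prodMk continuous_snd)
  · simp [H.extend_apply_of_le_zero ht, ι]
  · simp [H.extend_apply_of_one_le ht, wS]
  · rw [hR χ h1 h2 h3]
    push_cast
    rfl

theorem exists_contDiff_between {K U : Set (Euc n)} (hK : IsCompact K) (hU : IsOpen U)
    (hKU : K ⊆ U) : ∃ χ : Euc n → ℝ, ContDiff ℝ 1 χ ∧ HasCompactSupport χ ∧ (∀ x ∈ K, χ x = 1) ∧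
      (∀ x ∉ U, χ x = 0) ∧ ∀ x, χ x ∈ Icc 0 1 := by
  obtain ⟨L, hL, hKL, hLU⟩ := exists_compact_between hK hU hKU
  obtain ⟨f, hf1, hf0, hf⟩ := exists_contMDiffMap_one_nhds_of_subset_interior
    (modelWithCornersSelf ℝ (Euc n)) (n := 1) hK.isClosed hKL
  refine ⟨f, f.contMDiff.contDiff, HasCompactSupport.intro hL fun x hx => hf0 x hx,
    fun x hx => hf1.self_of_nhdsSet x hx, fun x hx => hf0 x fun h => hx (hLU h), hf⟩

/-- The part of a set covered by the degree is covered by the image of the `1`-homogeneous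
extension. -/
theorem IsBrouwerDegree.exists_radius_volume_le (hn : 1 ≤ n) {f : C(Sph n, Euc n)}
    {p : Euc n} {hp : ∀ x, f x ≠ p} {d : ℤ} (hd : IsBrouwerDegree (normalizedMap f p hp) d)
    {w : Euc n → Euc n} (hw : ContDiff ℝ 1 w)
    (hwf : ∀ x : Sph n, ‖w x - (f x - p)‖ < ‖f x - p‖) :
    ∃ R : ℝ, ∀ K U : Set (Euc n), IsCompact K → IsOpen U → K ⊆ U → (∀ z ∈ U, R < ‖z‖) →
      ENNReal.ofReal |(d : ℝ)| * volume K ≤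
        ∫⁻ x in radialExt w ⁻¹' U, ENNReal.ofReal |(fderiv ℝ (radialExt w) x).det| := by
  obtain ⟨R, hR⟩ := hd.exists_radius_integral_radialExt hn hw hwf
  refine ⟨R, fun K U hK hU hKU hUR => ?_⟩
  obtain ⟨χ, hχ, hχc, hχ1, hχ0, hχI⟩ := exists_contDiff_between hK hU hKU
  have key := hR χ hχ hχc fun z hz => hχ0 z fun h => absurd (hUR z h) (not_lt.mpr hz)
  have hint : Integrable χ := hχ.continuous.integrable_of_hasCompactSupport hχc
  have h1 : volume K ≤ ENNReal.ofReal (∫ z, χ z) := by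
    rw [ofReal_integral_eq_lintegral_ofReal hint (Eventually.of_forall fun x => (hχI x).1),
      ← lintegral_indicator_one hK.measurableSet]
    refine lintegral_mono fun x => ?_
    by_cases hx : x ∈ K <;> simp [hx, hχ1]
  have hpos : 0 ≤ ∫ z, χ z := integral_nonneg fun x => (hχI x).1
  calc ENNReal.ofReal |(d : ℝ)| * volume K
      ≤ ENNReal.ofReal |(d : ℝ)| * ENNReal.ofReal (∫ z, χ z) := by gcongr
    _ = ‖∫ x, χ (radialExt w x) * (fderiv ℝ (radialExt w) x).det‖ₑ := by
        rw [key, ← ENNReal.ofReal_mul (abs_nonneg _), Real.enorm_eq_ofReal_abs, abs_mul,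
          abs_of_nonneg hpos]
    _ ≤ ∫⁻ x, ‖χ (radialExt w x) * (fderiv ℝ (radialExt w) x).det‖ₑ :=
        enorm_integral_le_lintegral_enorm _
    _ ≤ ∫⁻ x, (radialExt w ⁻¹' U).indicator
          (fun x => ENNReal.ofReal |(fderiv ℝ (radialExt w) x).det|) x := by
        refine lintegral_mono fun x => ?_
        by_cases hx : x ∈ radialExt w ⁻¹' U
        · rw [indicator_of_mem hx, Real.enorm_eq_ofReal_abs, abs_mul,
            abs_of_nonneg (hχI _).1]
          exact ENNReal.ofReal_le_ofReal (mul_le_of_le_one_left (abs_nonneg _) (hχI _).2)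
        · rw [indicator_of_notMem hx, hχ0 _ hx]
          simp
    _ ≤ _ := lintegral_indicator_le _ _

end DegreeIntegral

/-! ### Hausdorff measure on the sphere and rotation invariance -/

section SphereMeasure

variable {n : ℕ}

theorem norm_coe_sph (x : Sph n) : ‖(x : Euc n)‖ = 1 := mem_sphere_zero_iff_norm.mp x.2

theorem finrank_orthogonal_sph (v : Sph n) :
    (Module.finrank ℝ (Submodule.span ℝ {(v : Euc n)})ᗮ : ℝ) = (n : ℝ) - 1 := by
  have hv : (v : Euc n) ≠ 0 := norm_ne_zero_iff.mp (by rw [norm_coe_sph]; norm_num)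
  have h1 := Submodule.finrank_add_finrank_orthogonal (𝕜 := ℝ) (Submodule.span ℝ {(v : Euc n)})
  rw [finrank_span_singleton hv, finrank_euclideanSpace, Fintype.card_fin] at h1
  have h2 : (1 : ℝ) + Module.finrank ℝ (Submodule.span ℝ {(v : Euc n)})ᗮ = n := by exact_mod_cast h1
  linarith

theorem norm_normalize_sub_normalize_le {F : Type*} [NormedAddCommGroup F] [NormedSpace ℝ F]
    {x y : F} (hx : 1 ≤ ‖x‖) (hy : 1 ≤ ‖y‖) : ‖‖x‖⁻¹ • x - ‖y‖⁻¹ • y‖ ≤ 2 * ‖x - y‖ := by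
  have hx0 : 0 < ‖x‖ := by linarith
  have hy0 : 0 < ‖y‖ := by linarith
  have h : ‖x‖⁻¹ • x - ‖y‖⁻¹ • y = ‖x‖⁻¹ • ((x - y) + ((‖y‖ - ‖x‖) * ‖y‖⁻¹) • y) := by
    rw [smul_add, smul_smul, smul_sub, sub_mul, mul_sub, mul_inv_cancel₀ hy0.ne', sub_smul,
      ← mul_assoc, inv_mul_cancel₀ hx0.ne', mul_one, one_mul]
    abel
  rw [h, norm_smul, norm_inv, norm_norm]
  have h2 : ‖(x - y) + ((‖y‖ - ‖x‖) * ‖y‖⁻¹) • y‖ ≤ 2 * ‖x - y‖ := by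
    refine (norm_add_le _ _).trans ?_
    rw [norm_smul, norm_mul, norm_inv, norm_norm, mul_assoc, inv_mul_cancel₀ hy0.ne', mul_one]
    have := abs_norm_sub_norm_le y x
    rw [norm_sub_rev] at this
    rw [Real.norm_eq_abs]
    linarith
  calc ‖x‖⁻¹ * ‖(x - y) + ((‖y‖ - ‖x‖) * ‖y‖⁻¹) • y‖ ≤ 1 * (2 * ‖x - y‖) := by
        gcongr
        exact inv_le_one_of_one_le₀ hx
    _ = _ := one_mul _

/-- Central projection from the tangent hyperplane at `v` is `2`-Lipschitz, because that plane stays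
at distance at least `1` from the origin. It maps a ball of radius `3` onto a set containing the
cap. On a space of dimension `n - 1` the Hausdorff measure is finite on compact sets. -/
theorem hausdorffMeasure_halfCap_lt_top (v : Sph n) :
    (Measure.hausdorffMeasure ((n : ℝ) - 1) : Measure (Euc n))
      {x | ‖x‖ = 1 ∧ 1 / 2 < inner ℝ x (v : Euc n)} < ⊤ := by
  let V := (Submodule.span ℝ {(v : Euc n)})ᗮ
  have hvV : ∀ w : V, inner ℝ (v : Euc n) (w : Euc n) = 0 := fun w =>
    Submodule.mem_orthogonal_singleton_iff_inner_right.mp w.2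
  have hge : ∀ w : V, 1 ≤ ‖(v : Euc n) + w‖ := fun w => by
    have := norm_add_sq_real (v : Euc n) w
    rw [hvV, norm_coe_sph] at this
    nlinarith [norm_nonneg ((v : Euc n) + w), sq_nonneg ‖(w : Euc n)‖]
  let ρ : V → Euc n := fun w => ‖(v : Euc n) + w‖⁻¹ • ((v : Euc n) + w)
  have hρ : LipschitzWith 2 ρ := LipschitzWith.of_dist_le_mul fun a b => by
    rw [dist_eq_norm, dist_eq_norm]
    refine (norm_normalize_sub_normalize_le (hge a) (hge b)).trans ?_
    simp
  have hsub : {x : Euc n | ‖x‖ = 1 ∧ 1 / 2 < inner ℝ x (v : Euc n)} ⊆ ρ '' closedBall 0 3 := by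
    rintro x ⟨hx, hxv⟩
    set t := inner ℝ x (v : Euc n) with ht
    have ht0 : 0 < t := by linarith
    have hmem : t⁻¹ • x - (v : Euc n) ∈ V := by
      rw [Submodule.mem_orthogonal_singleton_iff_inner_left, inner_sub_left,
        real_inner_self_eq_norm_sq, norm_coe_sph, real_inner_smul_left, ← ht,
        inv_mul_cancel₀ ht0.ne']
      norm_num
    refine ⟨⟨_, hmem⟩, ?_, ?_⟩
    · rw [mem_closedBall_zero_iff, Submodule.coe_norm]
      refine (norm_sub_le _ _).trans ?_
      rw [norm_smul, hx, norm_coe_sph, norm_inv, Real.norm_of_nonneg ht0.le, mul_one]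
      have : t⁻¹ ≤ 2 := by
        rw [inv_le_comm₀ ht0 (by norm_num)]; linarith
      linarith
    · simp only [ρ, add_sub_cancel]
      rw [norm_smul, hx, norm_inv, Real.norm_of_nonneg ht0.le, mul_one, inv_inv, smul_smul,
        mul_inv_cancel₀ ht0.ne', one_smul]
  have hfin : (Measure.hausdorffMeasure ((n : ℝ) - 1) : Measure V) (closedBall 0 3) < ⊤ := by
    rw [← finrank_orthogonal_sph v]
    exact (isCompact_closedBall _ _).measure_lt_top
  have hnn : 0 ≤ (n : ℝ) - 1 := by rw [← finrank_orthogonal_sph v]; positivity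
  refine (measure_mono hsub).trans_lt
    ((hρ.hausdorffMeasure_image_le hnn _).trans_lt (ENNReal.mul_lt_top ?_ hfin))
  exact ENNReal.rpow_lt_top_of_nonneg hnn (by simp)

theorem sphMeasure_image (hn : 1 ≤ n) (s : Set (Sph n)) :
    (Measure.hausdorffMeasure ((n : ℝ) - 1) : Measure (Euc n)) (Subtype.val '' s) =
      sphMeasure n s :=
  isometry_subtype_coe.hausdorffMeasure_image
    (Or.inl (by have : (1 : ℝ) ≤ n := by exact_mod_cast hn
                linarith)) s

theorem isFiniteMeasure_sphMeasure (hn : 1 ≤ n) : IsFiniteMeasure (sphMeasure n) := by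
  refine ⟨isCompact_univ.measure_lt_top_of_nhdsWithin fun v _ => ?_⟩
  rw [nhdsWithin_univ]
  refine ⟨{x | 1 / 2 < inner ℝ (x : Euc n) (v : Euc n)}, ?_, ?_⟩
  · refine (isOpen_lt continuous_const (by fun_prop)).mem_nhds ?_
    change 1 / 2 < inner ℝ (v : Euc n) (v : Euc n)
    rw [real_inner_self_eq_norm_sq, norm_coe_sph]; norm_num
  · rw [← sphMeasure_image hn]
    refine (measure_mono ?_).trans_lt (hausdorffMeasure_halfCap_lt_top v)
    rintro _ ⟨x, hx, rfl⟩
    exact ⟨norm_coe_sph x, hx⟩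

theorem nonempty_sph (hn : 1 ≤ n) : Nonempty (Sph n) := by
  have : Nonempty (Fin n) := ⟨⟨0, hn⟩⟩
  exact (NormedSpace.sphere_nonempty.mpr zero_le_one).to_subtype

/-- Orthogonal projection onto the hyperplane `v⊥` does not increase Hausdorff measure, and the
image of the sphere contains the open unit ball of that hyperplane. -/
theorem sphMeasure_ne_zero (hn : 1 ≤ n) : sphMeasure n ≠ 0 := by
  intro h0
  obtain ⟨v⟩ := nonempty_sph hn
  let V := (Submodule.span ℝ {(v : Euc n)})ᗮ
  have hnn : 0 ≤ (n : ℝ) - 1 := by rw [← finrank_orthogonal_sph v]; positivity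
  have h1 : (Measure.hausdorffMeasure ((n : ℝ) - 1) : Measure (Euc n))
      (Subtype.val '' (univ : Set (Sph n))) = 0 := by rw [sphMeasure_image hn, h0]; simp
  have h2 := hausdorffMeasure_orthogonalProjectionOnto_le V ((n : ℝ) - 1)
    (Subtype.val '' (univ : Set (Sph n))) hnn
  rw [h1, nonpos_iff_eq_zero] at h2
  have h3 : ball (0 : V) 1 ⊆ V.orthogonalProjectionOnto '' (Subtype.val '' (univ : Set (Sph n))) := by
    intro w hw
    have hw1 : ‖(w : Euc n)‖ < 1 := by simpa using hw
    have hvw : inner ℝ (v : Euc n) (w : Euc n) = 0 :=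
      Submodule.mem_orthogonal_singleton_iff_inner_right.mp w.2
    have hsq : 0 ≤ 1 - ‖(w : Euc n)‖ ^ 2 := by nlinarith [norm_nonneg (w : Euc n)]
    refine ⟨√(1 - ‖(w : Euc n)‖ ^ 2) • (v : Euc n) + w, ?_, ?_⟩
    · refine ⟨⟨_, mem_sphere_zero_iff_norm.mpr ?_⟩, mem_univ _, rfl⟩
      rw [← sq_eq_sq₀ (norm_nonneg _) zero_le_one, norm_add_sq_real, norm_smul,
        real_inner_smul_left, hvw, norm_coe_sph, Real.norm_of_nonneg (Real.sqrt_nonneg _), mul_one,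
        Real.sq_sqrt hsq]
      ring
    · rw [map_add, map_smul]
      have hv0 : V.orthogonalProjectionOnto (v : Euc n) = 0 := by
        rw [Submodule.orthogonalProjectionOnto_eq_zero_iff]
        exact Submodule.le_orthogonal_orthogonal _ (Submodule.mem_span_singleton_self _)
      simp [hv0]
  have h4 := measure_mono_null h3 h2
  rw [← finrank_orthogonal_sph v] at h4
  exact (isOpen_ball.measure_pos _ (nonempty_ball.mpr one_pos)).ne' h4

/-- The action of a linear isometry on the unit sphere. -/
noncomputable def sphIsometry (e : Euc n ≃ₗᵢ[ℝ] Euc n) : Sph n ≃ᵢ Sph n where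
  toFun x := ⟨e x, by simp⟩
  invFun x := ⟨e.symm x, by simp⟩
  left_inv x := by simp
  right_inv x := by simp
  isometry_toFun := fun x y => by
    simp only [Subtype.edist_eq]
    exact e.isometry _ _

/-- Measures on the sphere invariant under all linear isometries. -/
def IsRotationInvariant (μ : Measure (Sph n)) : Prop :=
  ∀ e : Euc n ≃ₗᵢ[ℝ] Euc n, MeasurePreserving (sphIsometry e) μ μ

theorem isRotationInvariant_sphMeasure : IsRotationInvariant (sphMeasure n) := fun e =>
  (sphIsometry e).measurePreserving_hausdorffMeasure _

theorem isRotationInvariant_toSphere :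
    IsRotationInvariant (volume : Measure (Euc n)).toSphere := fun e => by
  refine ⟨(sphIsometry e).continuous.measurable, Measure.ext fun s hs => ?_⟩
  have hc := (sphIsometry e).continuous.measurable
  rw [Measure.map_apply hc hs, Measure.toSphere_apply' _ hs, Measure.toSphere_apply' _ (hc hs)]
  congr 1
  have : Ioo (0 : ℝ) 1 • (Subtype.val '' (sphIsometry e ⁻¹' s)) =
      e ⁻¹' (Ioo (0 : ℝ) 1 • (Subtype.val '' s)) := by
    ext x
    simp only [Set.mem_smul, mem_preimage]
    constructor
    · rintro ⟨t, ht, _, ⟨u, hu, rfl⟩, rfl⟩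
      exact ⟨t, ht, _, ⟨_, hu, rfl⟩, (map_smul e t (u : Euc n)).symm⟩
    · rintro ⟨t, ht, _, ⟨u, hu, rfl⟩, hx⟩
      refine ⟨t, ht, _, ⟨(sphIsometry e).symm u, by simpa using hu, rfl⟩, ?_⟩
      apply e.injective
      rw [← hx, map_smul]
      congr 1
      exact congrArg Subtype.val ((sphIsometry e).apply_symm_apply u)
  rw [this]
  exact e.measurePreserving.measure_preimage_emb e.toHomeomorph.measurableEmbedding _

theorem exists_isometry_map_eq (x y : Sph n) :
    ∃ e : Euc n ≃ₗᵢ[ℝ] Euc n, sphIsometry e x = y :=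
  ⟨((Submodule.span ℝ {(x : Euc n) - y})ᗮ).reflection,
    Subtype.ext (Submodule.reflection_sub (by rw [norm_coe_sph, norm_coe_sph]))⟩

/-- An isometry moves one pole to the other. Hence one normalising constant serves a zonal kernel at
every point. -/
theorem IsRotationInvariant.integral_zonal {μ : Measure (Sph n)} (hμ : IsRotationInvariant μ)
    (k : ℝ → ℝ) (x x' : Sph n) :
    ∫ y : Sph n, k (inner ℝ (x : Euc n) (y : Euc n)) ∂μ =
      ∫ y : Sph n, k (inner ℝ (x' : Euc n) (y : Euc n)) ∂μ := by
  obtain ⟨e, he⟩ := exists_isometry_map_eq x x'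
  rw [← (hμ e).integral_comp (sphIsometry e).toHomeomorph.measurableEmbedding
    fun y : Sph n => k (inner ℝ (x' : Euc n) (y : Euc n))]
  refine integral_congr_ae (Eventually.of_forall fun y => ?_)
  simp only
  rw [← he]
  congr 1
  exact (e.inner_map_map _ _).symm

/-- A smooth zonal profile, positive exactly on the cap `t > 1 - δ`. -/
noncomputable def zonalBump (δ t : ℝ) : ℝ := Real.smoothTransition (t - (1 - δ))

theorem contDiff_zonalBump (δ : ℝ) : ContDiff ℝ ∞ (zonalBump δ) :=
  Real.smoothTransition.contDiff.comp (contDiff_id.sub contDiff_const)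

theorem zonalBump_nonneg (δ t : ℝ) : 0 ≤ zonalBump δ t := Real.smoothTransition.nonneg _

/-- On the sphere `|x - y|² = 2 - 2⟨x, y⟩`, so a cap of height `δ² / 2` has chordal radius `δ`. -/
theorem dist_lt_of_zonalBump_ne_zero {δ : ℝ} {x y : Sph n}
    (h : zonalBump (δ ^ 2 / 2) (inner ℝ (x : Euc n) (y : Euc n)) ≠ 0) (hδ : 0 < δ) :
    dist x y < δ := by
  have h1 : 1 - δ ^ 2 / 2 < inner ℝ (x : Euc n) (y : Euc n) := by
    by_contra h2
    exact h (Real.smoothTransition.zero_of_nonpos (by linarith [not_lt.mp h2]))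
  rw [Subtype.dist_eq, dist_eq_norm]
  have h2 := norm_sub_sq_real (x : Euc n) y
  rw [norm_coe_sph, norm_coe_sph] at h2
  exact lt_of_pow_lt_pow_left₀ 2 hδ.le (by linarith)

theorem integral_zonalBump_pos {μ : Measure (Sph n)} [IsFiniteMeasure μ] [μ.IsOpenPosMeasure]
    {δ : ℝ} (hδ : 0 < δ) (x : Sph n) :
    0 < ∫ y : Sph n, zonalBump δ (inner ℝ (x : Euc n) (y : Euc n)) ∂μ := by
  have hc : Continuous fun y : Sph n => zonalBump δ (inner ℝ (x : Euc n) (y : Euc n)) :=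
    (contDiff_zonalBump δ).continuous.comp (by fun_prop)
  refine hc.integral_pos_of_hasCompactSupport_nonneg_nonzero
    (HasCompactSupport.of_compactSpace _) (fun y => zonalBump_nonneg _ _) (x := x) ?_
  rw [real_inner_self_eq_norm_sq, norm_coe_sph]
  exact (Real.smoothTransition.pos_of_pos (by linarith)).ne'

end SphereMeasure

/-! ### Proportionality of rotation invariant measures -/

section SphereUniqueness

variable {n : ℕ}

theorem continuous_zonal (δ : ℝ) : Continuous fun p : Sph n × Sph n =>
    zonalBump δ (inner ℝ (p.1 : Euc n) (p.2 : Euc n)) :=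
  (contDiff_zonalBump δ).continuous.comp (by fun_prop)

/-- Finite rotation invariant measures on the sphere are proportional. -/
theorem IsRotationInvariant.eq_smul [Nonempty (Sph n)] {μ ν : Measure (Sph n)} [IsFiniteMeasure μ]
    [IsFiniteMeasure ν] [ν.IsOpenPosMeasure] (hμ : IsRotationInvariant μ)
    (hν : IsRotationInvariant ν) : μ = (μ univ / ν univ) • ν := by
  have hν0 : ν univ ≠ 0 := (isOpen_univ.measure_pos ν univ_nonempty).ne'
  have hct : μ univ / ν univ ≠ ⊤ := ENNReal.div_ne_top (measure_ne_top _ _) hν0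
  have hfin : IsFiniteMeasure ((μ univ / ν univ) • ν) := ν.smul_finite hct
  set c : ℝ := (μ univ / ν univ).toReal with hc
  have hcν : c * ν.real univ = μ.real univ := by
    rw [hc, ENNReal.toReal_div, Measure.real, Measure.real, div_mul_cancel₀]
    exact (ENNReal.toReal_pos hν0 (measure_ne_top _ _)).ne'
  have hνpos : 0 < ν.real univ := ENNReal.toReal_pos hν0 (measure_ne_top _ _)
  refine ext_of_forall_integral_eq_of_IsFiniteMeasure fun φ => ?_
  rw [integral_smul_measure, ← hc, smul_eq_mul, ← sub_eq_zero, ← abs_nonpos_iff]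
  refine le_of_forall_pos_le_add fun ε hε => ?_
  set M := μ.real univ with hM
  have hM0 : 0 ≤ M := measureReal_nonneg
  set η := ε / (M + 1) with hη
  have hηpos : 0 < η := by positivity
  obtain ⟨δ, hδ, hφδ⟩ := Metric.uniformContinuous_iff.mp
    (CompactSpace.uniformContinuous_of_continuous φ.continuous) η hηpos
  -- The double integrals of `k(x, y) φ(x)` and `k(x, y) φ(y)` equal `κν ∫ φ dμ` and `κμ ∫ φ dν`.
  -- They are close because `k` lives where `φ` varies by less than `η`. The case `φ = 1` gives `κμ
  -- = κν c`.
  let k : Sph n → Sph n → ℝ := fun x y => zonalBump (δ ^ 2 / 2) (inner ℝ (x : Euc n) (y : Euc n))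
  have hkc : Continuous fun p : Sph n × Sph n => k p.1 p.2 := continuous_zonal _
  have hk0 : ∀ x y, 0 ≤ k x y := fun x y => zonalBump_nonneg _ _
  have hint : ∀ (m : Measure (Sph n)) [IsFiniteMeasure m] (g : Sph n → ℝ), Continuous g →
      Integrable g m := fun m _ g hg =>
    hg.integrable_of_hasCompactSupport (HasCompactSupport.of_compactSpace _)
  have hint2 : ∀ g : Sph n × Sph n → ℝ, Continuous g → Integrable g (μ.prod ν) := fun g hg =>
    hg.integrable_of_hasCompactSupport (HasCompactSupport.of_compactSpace _)
  obtain ⟨x₀⟩ := ‹Nonempty (Sph n)›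
  set κν := ∫ y, k x₀ y ∂ν with hκν
  set κμ := ∫ y, k x₀ y ∂μ with hκμ
  have hνx : ∀ x, ∫ y, k x y ∂ν = κν := fun x => hν.integral_zonal (zonalBump (δ ^ 2 / 2)) x x₀
  have hμx : ∀ y, ∫ x, k x y ∂μ = κμ := fun y => by
    rw [hκμ, ← hμ.integral_zonal (zonalBump (δ ^ 2 / 2)) y x₀]
    simp only [k, real_inner_comm]
  have hκpos : 0 < κν := integral_zonalBump_pos (by positivity) x₀
  have hA : ∀ ψ : Sph n → ℝ, Continuous ψ → ∫ x, ∫ y, k x y * ψ x ∂ν ∂μ = κν * ∫ x, ψ x ∂μ :=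
    fun ψ _ => by simp only [integral_mul_const, hνx, integral_const_mul]
  have hB : ∀ ψ : Sph n → ℝ, Continuous ψ → ∫ x, ∫ y, k x y * ψ y ∂ν ∂μ = κμ * ∫ x, ψ x ∂ν :=
    fun ψ hψ => by
      rw [integral_integral_swap (f := fun x y => k x y * ψ y)
        (hint2 _ (hkc.mul (hψ.comp continuous_snd)))]
      simp only [integral_mul_const, hμx, integral_const_mul]
  have hκ : κμ = κν * c := by
    have h1 := hA (fun _ => 1) continuous_const
    rw [hB (fun _ => 1) continuous_const] at h1
    simp only [integral_const, smul_eq_mul, mul_one] at h1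
    rw [← hM, ← hcν, ← mul_assoc] at h1
    exact mul_right_cancel₀ hνpos.ne' h1
  have hdiff : ‖κν * ∫ x, φ x ∂μ - κμ * ∫ x, φ x ∂ν‖ ≤ η * κν * M := by
    rw [← hA φ φ.continuous, ← hB φ φ.continuous, ← integral_sub]
    · refine norm_integral_le_of_norm_le_const (Eventually.of_forall fun x => ?_)
      rw [← integral_sub (hint ν _ (by fun_prop)) (hint ν _ (by fun_prop)), ← hνx x,
        ← integral_const_mul]
      refine norm_integral_le_of_norm_le (hint ν _ (by fun_prop)) (Eventually.of_forall fun y => ?_)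
      rw [← mul_sub, norm_mul, Real.norm_of_nonneg (hk0 x y), mul_comm]
      by_cases hk : k x y = 0
      · simp [hk]
      · gcongr
        · exact hk0 x y
        · rw [← dist_eq_norm]
          exact (hφδ (dist_lt_of_zonalBump_ne_zero hk hδ)).le
    · exact (hint2 _ (hkc.mul (φ.continuous.comp continuous_fst))).integral_prod_left
    · exact (hint2 _ (hkc.mul (φ.continuous.comp continuous_snd))).integral_prod_left
  rw [hκ, mul_assoc, ← mul_sub, norm_mul, Real.norm_of_nonneg hκpos.le, mul_assoc, mul_left_comm,
    mul_le_mul_iff_right₀ hκpos, Real.norm_eq_abs] at hdiff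
  rw [zero_add]
  refine hdiff.trans ?_
  rw [hη, div_mul_eq_mul_div, div_le_iff₀ (by positivity)]
  nlinarith

/-- Polar coordinates use `toSphere`, the theorem uses Hausdorff measure. The value of `c` is
immaterial, as it appears on both sides of the estimates. -/
theorem exists_sphMeasure_eq_smul_toSphere (hn : 1 ≤ n) :
    ∃ c : ENNReal, c ≠ 0 ∧ c ≠ ⊤ ∧ sphMeasure n = c • (volume : Measure (Euc n)).toSphere := by
  have := isFiniteMeasure_sphMeasure hn
  have hS := nonempty_sph hn
  refine ⟨_, ?_, ?_, isRotationInvariant_sphMeasure.eq_smul isRotationInvariant_toSphere⟩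
  · exact ENNReal.div_ne_zero.mpr
      ⟨by rw [Ne, Measure.measure_univ_eq_zero]; exact sphMeasure_ne_zero hn, measure_ne_top _ _⟩
  · exact ENNReal.div_ne_top (measure_ne_top _ _) (isOpen_univ.measure_pos _ univ_nonempty).ne'

theorem isOpenPosMeasure_sphMeasure (hn : 1 ≤ n) : (sphMeasure n).IsOpenPosMeasure := by
  obtain ⟨c, hc0, -, hc⟩ := exists_sphMeasure_eq_smul_toSphere hn
  refine ⟨fun U hU hne h => ?_⟩
  rw [hc, Measure.smul_apply, smul_eq_mul, mul_eq_zero] at h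
  exact (hU.measure_pos _ hne).ne' (h.resolve_left hc0)

end SphereUniqueness

/-! ### Differentiation under the integral over a compact space -/

section ParametricIntegral

variable {H F Y : Type*} [NormedAddCommGroup H] [NormedSpace ℝ H] [ProperSpace H]
  [NormedAddCommGroup F] [NormedSpace ℝ F] [MetricSpace Y] [CompactSpace Y]
  [MeasurableSpace Y] [BorelSpace Y]

theorem hasFDerivAt_integral_of_compactSpace (μ : Measure Y) [IsFiniteMeasure μ] {φ : H → Y → F}
    {φ' : H → Y → H →L[ℝ] F} (hφ : Continuous φ.uncurry) (hφ' : Continuous φ'.uncurry)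
    (hder : ∀ x y, HasFDerivAt (φ · y) (φ' x y) x) (x : H) :
    HasFDerivAt (fun x => ∫ y, φ x y ∂μ) (∫ y, φ' x y ∂μ) x := by
  obtain ⟨b, hb⟩ := (((isCompact_closedBall x 1).prod (isCompact_univ (X := Y))).image
    hφ').isBounded.exists_norm_le
  have h1 : ∀ z, Continuous (φ z) := fun z => hφ.comp (by fun_prop : Continuous fun y => (z, y))
  have h2 : ∀ z, Continuous (φ' z) := fun z => hφ'.comp (by fun_prop : Continuous fun y => (z, y))
  refine hasFDerivAt_integral_of_dominated_of_fderiv_le (bound := fun _ => b)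
    (ball_mem_nhds x one_pos)
    (Eventually.of_forall fun z => (h1 z).aestronglyMeasurable)
    ((h1 x).integrable_of_hasCompactSupport (HasCompactSupport.of_compactSpace _))
    (h2 x).aestronglyMeasurable
    (Eventually.of_forall fun y z hz => hb _ ⟨(z, y), ⟨ball_subset_closedBall hz, mem_univ _⟩, rfl⟩)
    (integrable_const _) (Eventually.of_forall fun y z _ => hder z y)

theorem contDiff_one_integral_of_compactSpace (μ : Measure Y) [IsFiniteMeasure μ] {φ : H → Y → F}
    {φ' : H → Y → H →L[ℝ] F} (hφ : Continuous φ.uncurry) (hφ' : Continuous φ'.uncurry)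
    (hder : ∀ x y, HasFDerivAt (φ · y) (φ' x y) x) :
    ContDiff ℝ 1 (fun x => ∫ y, φ x y ∂μ) := by
  refine contDiff_one_iff_hasFDerivAt.mpr
    ⟨_, ?_, hasFDerivAt_integral_of_compactSpace μ hφ hφ' hder⟩
  have := continuous_parametric_integral_of_continuous (μ := μ) hφ' isCompact_univ
  simpa only [Measure.restrict_univ] using this

end ParametricIntegral

/-! ### Jensen's inequality for a probability density -/

section Jensen

theorem lintegral_mul_pow_le {Y F : Type*} [MeasurableSpace Y] [NormedAddCommGroup F]
    {μ : Measure Y} {k : Y → ENNReal} (hk : Measurable k) (hk1 : ∫⁻ y, k y ∂μ = 1) {A : Y → F}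
    (hA : AEStronglyMeasurable A μ) {p : ℕ} (hp : 1 ≤ p) :
    (∫⁻ y, k y * ‖A y‖ₑ ∂μ) ^ p ≤ ∫⁻ y, k y * ‖A y‖ₑ ^ p ∂μ := by
  have hprob : IsProbabilityMeasure (μ.withDensity k) := ⟨by
    rw [withDensity_apply _ .univ, Measure.restrict_univ, hk1]⟩
  have hA' : AEStronglyMeasurable A (μ.withDensity k) :=
    hA.mono_ac (withDensity_absolutelyContinuous _ _)
  have h := eLpNorm_le_eLpNorm_of_exponent_le (p := 1) (q := p) (by exact_mod_cast hp) hA'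
  rw [eLpNorm_one_eq_lintegral_enorm, eLpNorm_eq_lintegral_rpow_enorm_toReal
    (by exact_mod_cast (by omega : p ≠ 0)) (ENNReal.natCast_ne_top p), ENNReal.toReal_natCast,
    lintegral_withDensity_eq_lintegral_mul₀ hk.aemeasurable hA.enorm,
    lintegral_withDensity_eq_lintegral_mul₀ hk.aemeasurable (hA.enorm.pow_const _)] at h
  have hp0 : (p : ℝ) ≠ 0 := by exact_mod_cast (by omega : p ≠ 0)
  have h' := pow_le_pow_left' h p
  rw [← ENNReal.rpow_natCast (_ ^ (1 / (p : ℝ))), ← ENNReal.rpow_mul, one_div,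
    inv_mul_cancel₀ hp0, ENNReal.rpow_one] at h'
  simpa only [Pi.mul_apply, ENNReal.rpow_natCast] using h'

end Jensen

/-! ### Zonal averaging and rotation fields -/

section Mollify

variable {n : ℕ}

/-- Averaging a map on the sphere against a zonal kernel. -/
noncomputable def sphMollify (k : ℝ → ℝ) (f : Sph n → Euc n) (x : Euc n) : Euc n :=
  ∫ y : Sph n, k (inner ℝ x (y : Euc n)) • f y ∂(sphMeasure n)

theorem hasFDerivAt_zonal_smul {k : ℝ → ℝ} (hk : ContDiff ℝ ∞ k) (z : Euc n) (x y : Euc n) :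
    HasFDerivAt (fun x : Euc n => k (inner ℝ x y) • z)
      ((deriv k (inner ℝ x y) • innerSL ℝ y).smulRight z) x := by
  have h1 : HasFDerivAt (fun x : Euc n => inner ℝ x y) (innerSL ℝ y) x := by
    have := (innerSL ℝ y).hasFDerivAt (x := x)
    refine this.congr_of_eventuallyEq (Eventually.of_forall fun w => ?_)
    simp [real_inner_comm]
  exact ((hk.differentiable (by norm_num) _).hasDerivAt.comp_hasFDerivAt x h1).smul_const z

theorem continuous_deriv_zonal_smul {k : ℝ → ℝ} (hk : ContDiff ℝ ∞ k) (f : C(Sph n, Euc n)) :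
    Continuous (Function.uncurry fun (x : Euc n) (y : Sph n) =>
      (deriv k (inner ℝ x (y : Euc n)) • innerSL ℝ (y : Euc n)).smulRight (f y)) := by
  have hd : Continuous (deriv k) := hk.continuous_deriv (by norm_num)
  have h1 : Continuous fun p : Euc n × Sph n =>
      deriv k (inner ℝ p.1 (p.2 : Euc n)) • innerSL ℝ (p.2 : Euc n) :=
    (hd.comp (by fun_prop)).smul ((innerSL ℝ).continuous.comp (by fun_prop))
  exact (((ContinuousLinearMap.smulRightL ℝ (Euc n) (Euc n)).continuous.comp h1).clm_apply
    (f.continuous.comp continuous_snd))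

theorem continuous_zonal_smul {k : ℝ → ℝ} (hk : ContDiff ℝ ∞ k) (f : C(Sph n, Euc n)) :
    Continuous (Function.uncurry fun (x : Euc n) (y : Sph n) =>
      k (inner ℝ x (y : Euc n)) • f y) :=
  (hk.continuous.comp (by fun_prop : Continuous fun p : Euc n × Sph n =>
    inner ℝ p.1 (p.2 : Euc n))).smul (f.continuous.comp continuous_snd)

theorem contDiff_sphMollify [IsFiniteMeasure (sphMeasure n)] {k : ℝ → ℝ} (hk : ContDiff ℝ ∞ k)
    (f : C(Sph n, Euc n)) : ContDiff ℝ 1 (sphMollify k f) :=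
  contDiff_one_integral_of_compactSpace _ (continuous_zonal_smul hk f)
    (continuous_deriv_zonal_smul hk f) fun x y => hasFDerivAt_zonal_smul hk (f y) x y

theorem fderiv_sphMollify_apply [IsFiniteMeasure (sphMeasure n)] {k : ℝ → ℝ} (hk : ContDiff ℝ ∞ k)
    (f : C(Sph n, Euc n)) (x v : Euc n) :
    fderiv ℝ (sphMollify k f) x v =
      ∫ y : Sph n, (deriv k (inner ℝ x (y : Euc n)) * inner ℝ v (y : Euc n)) • f y
        ∂(sphMeasure n) := by
  have h := (hasFDerivAt_integral_of_compactSpace (sphMeasure n) (continuous_zonal_smul hk f)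
    (continuous_deriv_zonal_smul hk f) (fun x y => hasFDerivAt_zonal_smul hk (f y) x y) x).fderiv
  have h' : fderiv ℝ (sphMollify k f) x = _ := h
  have hc : Continuous fun y : Sph n =>
      (deriv k (inner ℝ x (y : Euc n)) • innerSL ℝ (y : Euc n)).smulRight (f y) :=
    (continuous_deriv_zonal_smul hk f).uncurry_left x
  rw [h', ContinuousLinearMap.integral_apply
    (hc.integrable_of_hasCompactSupport (HasCompactSupport.of_compactSpace _))]
  refine integral_congr_ae (Eventually.of_forall fun y => ?_)
  simp only [ContinuousLinearMap.smulRight_apply, smul_apply, innerSL_apply_apply, smul_eq_mul]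
  rw [real_inner_comm v]

/-- The rotation field `y ↦ ⟨x, y⟩ v - ⟨v, y⟩ x` weighted by a zonal kernel centred at `x`. -/
noncomputable def zonalField (k : ℝ → ℝ) (x v y : Euc n) : Euc n :=
  k (inner ℝ x y) • (inner ℝ x y • v - inner ℝ v y • x)

theorem inner_zonalField_self (k : ℝ → ℝ) (x v y : Euc n) :
    inner ℝ (zonalField k x v y) y = 0 := by
  simp only [zonalField, inner_smul_left, inner_sub_left, RCLike.conj_to_real]
  ring

theorem contDiff_zonalField {k : ℝ → ℝ} (hk : ContDiff ℝ ∞ k) (x v : Euc n) :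
    ContDiff ℝ ∞ (zonalField k x v) := by
  have h1 : ∀ z : Euc n, ContDiff ℝ ∞ fun y : Euc n => inner ℝ z y := fun z =>
    (innerSL ℝ z).contDiff
  exact (hk.comp (h1 x)).smul (((h1 x).smul contDiff_const).sub ((h1 v).smul contDiff_const))

/-- The rotation generator is skew, so it has no trace and no normal part, and only the term with
`k'` survives. The result is minus the derivative of the kernel in its centre `x` along `v`, so
testing the weak derivative with this field differentiates the average. -/
theorem sphereDiv_zonalField {k : ℝ → ℝ} (hk : ContDiff ℝ ∞ k) {x v : Euc n} (hx : ‖x‖ = 1)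
    (hxv : inner ℝ x v = 0) (y : Euc n) :
    sphereDiv (zonalField k x v) y = -(deriv k (inner ℝ x y) * inner ℝ v y) := by
  have h1 : ∀ z : Euc n, HasFDerivAt (fun y : Euc n => inner ℝ z y) (innerSL ℝ z) y := fun z =>
    (innerSL ℝ z).hasFDerivAt
  have hd : HasFDerivAt (zonalField k x v)
      (k (inner ℝ x y) • ((innerSL ℝ x).smulRight v - (innerSL ℝ v).smulRight x) +
        (deriv k (inner ℝ x y) • innerSL ℝ x).smulRight (inner ℝ x y • v - inner ℝ v y • x)) y :=
    ((hk.differentiable (by norm_num) _).hasDerivAt.comp_hasFDerivAt y (h1 x)).smul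
      (((h1 x).smul_const v).sub ((h1 v).smul_const x))
  rw [sphereDiv, hd.fderiv]
  have ht : ∀ (φ : Euc n →L[ℝ] ℝ) (z : Euc n),
      LinearMap.trace ℝ (Euc n) (φ.smulRight z : Euc n →ₗ[ℝ] Euc n) = φ z := fun φ z =>
    LinearMap.trace_smulRight (φ : Euc n →ₗ[ℝ] ℝ) z
  have hvx : inner ℝ v x = 0 := by rw [real_inner_comm, hxv]
  simp only [ContinuousLinearMap.toLinearMap_add, ContinuousLinearMap.toLinearMap_smul,
    ContinuousLinearMap.toLinearMap_sub, map_add, map_smul, map_sub, ht]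
  simp only [innerSL_apply_apply, add_apply, smul_apply,
    sub_apply, ContinuousLinearMap.smulRight_apply, inner_add_left,
    inner_smul_left, inner_sub_left, RCLike.conj_to_real,
    smul_eq_mul, hxv, hvx, real_inner_self_eq_norm_sq, hx]
  ring

/-- The rotation vector is as long as the projection of `y` to the plane of `x` and `v`, hence at
most `1`. No constant is lost in bounding the derivative of the average. -/
theorem norm_zonalField_le {k : ℝ → ℝ} (hk : ∀ t, 0 ≤ k t) {x v y : Euc n} (hx : ‖x‖ = 1)
    (hv : ‖v‖ = 1) (hy : ‖y‖ = 1) (hxv : inner ℝ x v = 0) :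
    ‖zonalField k x v y‖ ≤ k (inner ℝ x y) := by
  rw [zonalField, norm_smul, Real.norm_of_nonneg (hk _)]
  refine mul_le_of_le_one_right (hk _) ?_
  have hvx : inner ℝ v x = 0 := by rw [real_inner_comm, hxv]
  have h1 : ‖inner ℝ x y • v - inner ℝ v y • x‖ ^ 2 = inner ℝ x y ^ 2 + inner ℝ v y ^ 2 := by
    rw [norm_sub_sq_real, norm_smul, norm_smul, hx, hv, inner_smul_left, inner_smul_right, hvx]
    simp [sq_abs]
  have h2 : ‖inner ℝ x y • v - inner ℝ v y • x‖ ^ 2 =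
      inner ℝ (inner ℝ x y • v - inner ℝ v y • x) (inner ℝ x y • v - inner ℝ v y • x) :=
    (real_inner_self_eq_norm_sq _).symm
  have h3 : inner ℝ (inner ℝ x y • x + inner ℝ v y • v) y = inner ℝ x y ^ 2 + inner ℝ v y ^ 2 := by
    simp only [inner_add_left, inner_smul_left, RCLike.conj_to_real]; ring
  have h4 : ‖inner ℝ x y • x + inner ℝ v y • v‖ ^ 2 = inner ℝ x y ^ 2 + inner ℝ v y ^ 2 := by
    rw [norm_add_sq_real, norm_smul, norm_smul, hx, hv, inner_smul_left, inner_smul_right, hxv]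
    simp [sq_abs]
  have h5 := real_inner_le_norm (inner ℝ x y • x + inner ℝ v y • v) y
  rw [h3, hy, mul_one, ← h4] at h5
  rw [← sq_le_one_iff₀ (norm_nonneg _), h1, ← h4]
  have := norm_nonneg (inner ℝ x y • x + inner ℝ v y • v)
  nlinarith

/-- The tangential derivative of the average is bounded by the average of the weak derivative. -/
theorem IsWeakDeriv.enorm_fderiv_sphMollify_le [IsFiniteMeasure (sphMeasure n)]
    {f : C(Sph n, Euc n)}
    {A : Sph n → Euc n →L[ℝ] Euc n} (hA : IsWeakDeriv f A) {k : ℝ → ℝ} (hk : ContDiff ℝ ∞ k)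
    (hk0 : ∀ t, 0 ≤ k t) {x v : Euc n} (hx : ‖x‖ = 1) (hv : ‖v‖ = 1) (hxv : inner ℝ x v = 0) :
    ‖fderiv ℝ (sphMollify k f) x v‖ₑ ≤
      ∫⁻ y : Sph n, ENNReal.ofReal (k (inner ℝ x (y : Euc n))) * ‖A y‖ₑ ∂(sphMeasure n) := by
  have h1 := hA.integral_eq (zonalField k x v) (contDiff_zonalField hk x v)
    (fun y => inner_zonalField_self k x v y)
  have h2 : fderiv ℝ (sphMollify k f) x v =
      ∫ y : Sph n, A y (zonalField k x v y) ∂(sphMeasure n) := by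
    rw [h1, fderiv_sphMollify_apply hk, ← integral_neg]
    refine integral_congr_ae (Eventually.of_forall fun y => ?_)
    simp only [sphereDiv_zonalField hk hx hxv, neg_smul, neg_neg]
  rw [h2]
  refine (enorm_integral_le_lintegral_enorm _).trans (lintegral_mono fun y => ?_)
  refine ((A y).le_opENorm _).trans ?_
  rw [mul_comm]
  gcongr
  rw [← ofReal_norm]
  exact ENNReal.ofReal_le_ofReal (norm_zonalField_le hk0 hx hv (norm_coe_sph y) hxv)

theorem norm_sphMollify_sub_le [IsFiniteMeasure (sphMeasure n)] {f : C(Sph n, Euc n)} {k : ℝ → ℝ}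
    (hk : ContDiff ℝ ∞ k) (hk0 : ∀ t, 0 ≤ k t) {x : Sph n}
    (hk1 : ∫ y : Sph n, k (inner ℝ (x : Euc n) (y : Euc n)) ∂(sphMeasure n) = 1) {η : ℝ}
    (hη : ∀ y : Sph n, k (inner ℝ (x : Euc n) (y : Euc n)) ≠ 0 → ‖f y - f x‖ ≤ η) :
    ‖sphMollify k f x - f x‖ ≤ η := by
  have hkc : Continuous fun y : Sph n => k (inner ℝ (x : Euc n) (y : Euc n)) :=
    hk.continuous.comp (by fun_prop)
  have hint : ∀ {F : Type} [NormedAddCommGroup F] (g : Sph n → F), Continuous g →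
      Integrable g (sphMeasure n) := fun g hg =>
    hg.integrable_of_hasCompactSupport (HasCompactSupport.of_compactSpace _)
  have h1 : sphMollify k f x - f x =
      ∫ y : Sph n, k (inner ℝ (x : Euc n) (y : Euc n)) • (f y - f x) ∂(sphMeasure n) := by
    simp only [smul_sub]
    rw [integral_sub (hint _ (by fun_prop)) (hint _ (by fun_prop)), integral_smul_const, hk1,
      one_smul]
    rfl
  have h2 : η = ∫ y : Sph n, k (inner ℝ (x : Euc n) (y : Euc n)) * η ∂(sphMeasure n) := by
    rw [integral_mul_const, hk1, one_mul]
  rw [h1, h2]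
  refine norm_integral_le_of_norm_le (hint _ (by fun_prop)) (Eventually.of_forall fun y => ?_)
  rw [norm_smul, Real.norm_of_nonneg (hk0 _)]
  by_cases h : k (inner ℝ (x : Euc n) (y : Euc n)) = 0
  · simp [h]
  · exact mul_le_mul_of_nonneg_left (hη y h) (hk0 _)

end Mollify

/-! ### Jacobian of the homogeneous extension and polar coordinates -/

section RadialJacobian

variable {n : ℕ}

/-- Hadamard's inequality in an orthonormal basis. -/
theorem abs_det_le_prod_norm (M : Euc n →L[ℝ] Euc n) (b : OrthonormalBasis (Fin n) ℝ (Euc n)) :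
    |M.det| ≤ ∏ i, ‖M (b i)‖ := by
  have : Fact (Module.finrank ℝ (Euc n) = n) := ⟨finrank_euclideanSpace_fin⟩
  have h1 : M.det = b.toBasis.det (fun i => M (b i)) := by
    have := b.toBasis.det_comp (M : Euc n →ₗ[ℝ] Euc n) b.toBasis
    rw [b.toBasis.det_self, mul_one] at this
    rw [ContinuousLinearMap.det, ← this]
    congr 1
  rw [h1, ← b.toBasis.orientation.volumeForm_robust b rfl]
  exact Orientation.abs_volumeForm_apply_le _ _

theorem exists_orthonormalBasis_apply_eq (hn : 1 ≤ n) {x : Euc n} (hx : ‖x‖ = 1) :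
    ∃ b : OrthonormalBasis (Fin n) ℝ (Euc n), b ⟨0, hn⟩ = x := by
  obtain ⟨b, hb⟩ := Orthonormal.exists_orthonormalBasis_extension_of_card_eq (𝕜 := ℝ)
    (E := Euc n) (ι := Fin n) (by simp) (v := fun _ => x) (s := {⟨0, hn⟩}) (by
      rw [orthonormal_iff_ite]
      rintro ⟨i, hi⟩ ⟨j, hj⟩
      simp only [mem_singleton_iff] at hi hj
      subst hi hj
      simp [domRestrict, hx])
  exact ⟨b, hb _ rfl⟩

theorem fderiv_radialExt_apply {w : Euc n → Euc n} (hw : ContDiff ℝ 1 w) {x : Euc n}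
    (hx : ‖x‖ = 1) (v : Euc n) :
    fderiv ℝ (radialExt w) x v = inner ℝ x v • w x + fderiv ℝ w x (v - inner ℝ x v • x) := by
  have hx0 : x ≠ 0 := norm_ne_zero_iff.mp (by rw [hx]; norm_num)
  have hN : HasFDerivAt (fun z : Euc n => ‖z‖) (innerSL ℝ x) x := by
    have h1 := (hasStrictFDerivAt_norm_sq x).hasFDerivAt.sqrt (by rw [hx]; norm_num)
    have h2 : (fun z : Euc n => √(‖z‖ ^ 2)) = fun z => ‖z‖ := by
      ext z; exact Real.sqrt_sq (norm_nonneg z)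
    rw [h2] at h1
    refine h1.congr_fderiv ?_
    have h3 : √(‖x‖ ^ 2) = 1 := by simp [hx]
    rw [h3]
    ext v
    simp
  have hinv : HasFDerivAt (fun z : Euc n => ‖z‖⁻¹) (-innerSL ℝ x) x := by
    have := (hasDerivAt_inv (x := ‖x‖) (by rw [hx]; norm_num)).comp_hasFDerivAt x hN
    simpa [hx, Function.comp_def] using this
  have hρ : HasFDerivAt (fun z : Euc n => ‖z‖⁻¹ • z)
      (‖x‖⁻¹ • ContinuousLinearMap.id ℝ (Euc n) + (-innerSL ℝ x).smulRight x) x :=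
    hinv.smul (hasFDerivAt_id (𝕜 := ℝ) x)
  have hwρ : HasFDerivAt w (fderiv ℝ w x) (‖x‖⁻¹ • x) := by
    simpa [hx] using (hw.differentiable (by norm_num) x).hasFDerivAt
  have h := hN.smul (HasFDerivAt.comp (f := fun z : Euc n => ‖z‖⁻¹ • z) x hwρ hρ)
  have h' : fderiv ℝ (radialExt w) x = _ := h.fderiv
  rw [h']
  simp [hx, sub_eq_add_neg, add_comm]

theorem radialExt_smul {w : Euc n → Euc n} {r : ℝ} (hr : 0 < r) (x : Euc n) :
    radialExt w (r • x) = r • radialExt w x := by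
  simp only [radialExt, norm_smul, Real.norm_of_nonneg hr.le, mul_inv, smul_smul]
  rw [mul_assoc, mul_comm ‖x‖⁻¹, ← mul_assoc, inv_mul_cancel₀ hr.ne', one_mul]

theorem radialExt_coe (w : Euc n → Euc n) (x : Sph n) : radialExt w x = w x := by
  simp [radialExt]

theorem fderiv_radialExt_smul (w : Euc n → Euc n) {r : ℝ} (hr : 0 < r) (x : Euc n) :
    fderiv ℝ (radialExt w) (r • x) = fderiv ℝ (radialExt w) x := by
  have h1 : (fun z => radialExt w (r • z)) = fun z => r • radialExt w z :=
    funext fun z => radialExt_smul hr z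
  have h2 := fderiv_comp_smul (𝕜 := ℝ) (f := radialExt w) (x := x) r
  rw [h1, show (fun z => r • radialExt w z) = r • radialExt w from rfl,
    fderiv_const_smul_field] at h2
  exact (smul_right_injective _ hr.ne' h2).symm

/-- Hadamard's inequality is applied in an orthonormal basis starting with `x`. The column at `x` is
`w x`, and the other `n - 1` are tangential derivatives of `w`. -/
theorem ofReal_abs_det_fderiv_radialExt_le (hn : 1 ≤ n) {w : Euc n → Euc n} (hw : ContDiff ℝ 1 w)
    {x : Euc n} (hx : ‖x‖ = 1) {a : ENNReal}
    (ha : ∀ v : Euc n, ‖v‖ = 1 → inner ℝ x v = 0 → ‖fderiv ℝ w x v‖ₑ ≤ a) :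
    ENNReal.ofReal |(fderiv ℝ (radialExt w) x).det| ≤ ‖w x‖ₑ * a ^ (n - 1) := by
  obtain ⟨b, hb⟩ := exists_orthonormalBasis_apply_eq hn hx
  have h1 := ENNReal.ofReal_le_ofReal (abs_det_le_prod_norm (fderiv ℝ (radialExt w) x) b)
  rw [ENNReal.ofReal_prod_of_nonneg fun i _ => norm_nonneg _] at h1
  refine h1.trans ?_
  simp only [ofReal_norm]
  rw [← Finset.mul_prod_erase _ _ (Finset.mem_univ (⟨0, hn⟩ : Fin n))]
  refine mul_le_mul' (le_of_eq ?_) ?_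
  · rw [hb, fderiv_radialExt_apply hw hx, real_inner_self_eq_norm_sq, hx]
    simp
  · refine (Finset.prod_le_pow_card _ _ a fun i hi => ?_).trans (by simp)
    have hi0 : i ≠ ⟨0, hn⟩ := Finset.ne_of_mem_erase hi
    have hxi : inner ℝ x (b i) = 0 := by
      rw [← hb]; exact b.orthonormal.2 hi0.symm
    rw [fderiv_radialExt_apply hw hx, hxi]
    simpa using ha (b i) (b.orthonormal.1 i) hxi

theorem measurable_radialExt {w : Euc n → Euc n} (hw : ContDiff ℝ 1 w) :
    Measurable (radialExt w) :=
  measurable_norm.smul (hw.continuous.measurable.comp (measurable_norm.inv.smul measurable_id))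

/-- Integration in polar coordinates. -/
theorem lintegral_eq_lintegral_toSphere (hn : 1 ≤ n) {h : Euc n → ENNReal} (hh : Measurable h) :
    ∫⁻ z, h z = ∫⁻ x : Sph n, ∫⁻ r : Ioi (0 : ℝ), h ((r : ℝ) • (x : Euc n))
      ∂(Measure.volumeIoiPow (n - 1)) ∂(volume : Measure (Euc n)).toSphere := by
  have : Nonempty (Fin n) := ⟨⟨0, hn⟩⟩
  have hmp := (volume : Measure (Euc n)).measurePreserving_homeomorphUnitSphereProd
  rw [finrank_euclideanSpace_fin] at hmp
  have hm : Measurable fun p : Sph n × Ioi (0 : ℝ) => h ((p.2 : ℝ) • (p.1 : Euc n)) :=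
    hh.comp ((measurable_subtype_coe.comp measurable_snd).smul
      (measurable_subtype_coe.comp measurable_fst))
  rw [← lintegral_prod _ hm.aemeasurable, ← hmp.lintegral_comp hm,
    show ∫⁻ z, h z = ∫⁻ z in {(0 : Euc n)}ᶜ, h z by rw [restrict_compl_singleton],
    ← lintegral_subtype_comap (measurableSet_singleton _).compl]
  refine lintegral_congr fun z => ?_
  have hz : ‖(z : Euc n)‖ ≠ 0 := norm_ne_zero_iff.mpr z.2
  simp [smul_smul, mul_inv_cancel₀ hz]

/-- The interval `(0, r)` has mass `rⁿ / n`, and `2ⁿ - 1 ≥ 1`. -/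
theorem volumeIoiPow_Icc_ge (hn : 1 ≤ n) {R : ℝ} (hR : 0 < R) :
    ENNReal.ofReal (R ^ n / n) ≤
      Measure.volumeIoiPow (n - 1) {r : Ioi (0 : ℝ) | R ≤ r ∧ (r : ℝ) ≤ 2 * R} := by
  have h1 := Measure.volumeIoiPow_apply_Iio (n - 1) ⟨R, hR⟩
  have h2 := Measure.volumeIoiPow_apply_Iio (n - 1) ⟨2 * R, mem_Ioi.mpr (by positivity)⟩
  simp only [Nat.sub_add_cancel hn] at h1 h2
  have hcast : ((n - 1 : ℕ) : ℝ) + 1 = n := by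
    rw [Nat.cast_sub hn]; simp
  rw [hcast] at h1 h2
  have hn0 : (0 : ℝ) < n := by exact_mod_cast hn
  have hsub : Iio (⟨2 * R, mem_Ioi.mpr (by positivity)⟩ : Ioi (0 : ℝ)) ⊆
      Iio ⟨R, hR⟩ ∪ {r : Ioi (0 : ℝ) | R ≤ r ∧ (r : ℝ) ≤ 2 * R} := by
    intro r hr
    rcases lt_or_ge (r : ℝ) R with h | h
    · exact Or.inl h
    · exact Or.inr ⟨h, le_of_lt (show (r : ℝ) < 2 * R from hr)⟩
  have h3 := (measure_mono hsub).trans (measure_union_le (μ := Measure.volumeIoiPow (n - 1)) _ _)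
  rw [h1, h2] at h3
  have h4 : ENNReal.ofReal (R ^ n / n) + ENNReal.ofReal (R ^ n / n) ≤
      ENNReal.ofReal ((2 * R) ^ n / n) := by
    rw [← ENNReal.ofReal_add (by positivity) (by positivity)]
    refine ENNReal.ofReal_le_ofReal ?_
    rw [← two_mul, ← mul_div_assoc, mul_pow]
    gcongr
    calc (2 : ℝ) = 2 ^ 1 := (pow_one 2).symm
      _ ≤ 2 ^ n := pow_le_pow_right₀ (by norm_num) hn
  exact (ENNReal.add_le_add_iff_left ENNReal.ofReal_ne_top).mp (h4.trans h3)

end RadialJacobian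

/-! ### The cone estimate for `C¹` maps -/

section ConeEstimate

variable {n : ℕ}

/-- The degree is controlled by the Jacobian over the preimage of a cone. -/
theorem IsBrouwerDegree.mul_toSphere_le (hn : 1 ≤ n) {f : C(Sph n, Euc n)}
    {p : Euc n} {hp : ∀ x, f x ≠ p} {d : ℤ} (hd : IsBrouwerDegree (normalizedMap f p hp) d)
    {w : Euc n → Euc n} (hw : ContDiff ℝ 1 w)
    (hwf : ∀ x : Sph n, ‖w x - (f x - p)‖ < ‖f x - p‖) {C : Set (Euc n)} (hCo : IsOpen C)
    (hC : IsCone C) {K : Set (Sph n)} (hK : IsCompact K) (hKC : ∀ x ∈ K, (x : Euc n) ∈ C) :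
    ENNReal.ofReal |(d : ℝ)| * (volume : Measure (Euc n)).toSphere K ≤
      4 ^ n * ∫⁻ x in {x : Sph n | w x ∈ C}, ENNReal.ofReal |(fderiv ℝ (radialExt w) x).det| *
        (‖w x‖ₑ⁻¹) ^ n ∂(volume : Measure (Euc n)).toSphere := by
  set ν := (volume : Measure (Euc n)).toSphere with hν
  obtain ⟨R₀, hR₀⟩ := hd.exists_radius_volume_le hn hw hwf
  set R : ℝ := 2 * (|R₀| + 1) with hR
  have hRpos : 0 < R := by positivity
  have hn0 : (0 : ℝ) < n := by exact_mod_cast hn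
  have hw0 : ∀ x : Sph n, w x ≠ 0 := fun x h0 => by
    have := hwf x
    rw [h0, zero_sub, norm_neg] at this
    exact lt_irrefl _ this
  -- `L` is the shell over `K` of radii `R` to `2R`, with volume at least `ν(K) Rⁿ / n`. By
  -- homogeneity, the preimage of `U` on the ray through `x` is empty unless `w x ∈ C`, lies below
  -- radius `4R / |w x|`, and carries a constant Jacobian. The powers of `R` cancel and leave `4ⁿ
  -- |w|⁻ⁿ`.
  let U : Set (Euc n) := C ∩ {z | R / 2 < ‖z‖ ∧ ‖z‖ < 4 * R}
  let L : Set (Euc n) := (fun q : ℝ × Sph n => q.1 • (q.2 : Euc n)) '' (Icc R (2 * R) ×ˢ K)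
  have hL : IsCompact L := (isCompact_Icc.prod hK).image (by fun_prop)
  have hU : IsOpen U := hCo.inter
    ((isOpen_lt continuous_const continuous_norm).inter
      (isOpen_lt continuous_norm continuous_const))
  have hLU : L ⊆ U := by
    rintro _ ⟨⟨r, x⟩, ⟨hr, hx⟩, rfl⟩
    have hr0 : 0 < r := hRpos.trans_le hr.1
    refine ⟨hC r hr0 _ (hKC x hx), ?_⟩
    simp only [mem_ofPred_eq, norm_smul, norm_coe_sph, mul_one, Real.norm_of_nonneg hr0.le]
    exact ⟨by linarith [hr.1], by linarith [hr.2]⟩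
  have key := hR₀ L U hL hU hLU fun z hz => by
    have : R / 2 < ‖z‖ := hz.2.1
    rw [hR] at this
    linarith [le_abs_self R₀]
  have hvol : ν K * ENNReal.ofReal (R ^ n / n) ≤ volume L := by
    rw [← lintegral_indicator_one hL.measurableSet, lintegral_eq_lintegral_toSphere hn
      (measurable_one.indicator hL.measurableSet), ← hν, mul_comm,
      ← setLIntegral_const]
    refine (lintegral_mono fun x => volumeIoiPow_Icc_ge hn hRpos).trans ?_
    rw [← lintegral_indicator hK.measurableSet]
    refine lintegral_mono fun x => ?_
    by_cases hx : x ∈ K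
    · rw [indicator_of_mem hx, ← lintegral_indicator_one]
      · refine lintegral_mono fun r => ?_
        by_cases hr : r ∈ {r : Ioi (0 : ℝ) | R ≤ r ∧ (r : ℝ) ≤ 2 * R}
        · have : (r : ℝ) • (x : Euc n) ∈ L := ⟨((r : ℝ), x), ⟨hr, hx⟩, rfl⟩
          simp [hr, this]
        · simp [hr]
      · exact (isClosed_le continuous_const continuous_subtype_val).measurableSet.inter
          (isClosed_le continuous_subtype_val continuous_const).measurableSet
    · simp [hx]
  have hdetm : Measurable fun z => ENNReal.ofReal |(fderiv ℝ (radialExt w) z).det| :=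
    (ContinuousLinearMap.continuous_det.measurable.comp
      (measurable_fderiv ℝ (radialExt w))).abs.ennreal_ofReal
  have hWU : MeasurableSet (radialExt w ⁻¹' U) := measurable_radialExt hw hU.measurableSet
  have hCm : MeasurableSet {x : Sph n | w x ∈ C} :=
    ((hw.continuous.comp continuous_subtype_val).measurable) hCo.measurableSet
  have hint : ∫⁻ z in radialExt w ⁻¹' U, ENNReal.ofReal |(fderiv ℝ (radialExt w) z).det| ≤
      (∫⁻ x in {x : Sph n | w x ∈ C}, ENNReal.ofReal |(fderiv ℝ (radialExt w) x).det| *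
        (‖w x‖ₑ⁻¹) ^ n ∂ν) * ENNReal.ofReal ((4 * R) ^ n / n) := by
    rw [← lintegral_indicator hWU, lintegral_eq_lintegral_toSphere hn (hdetm.indicator hWU), ← hν,
      ← lintegral_mul_const' _ _ ENNReal.ofReal_ne_top, ← lintegral_indicator hCm]
    refine lintegral_mono fun x => ?_
    have hwx : 0 < ‖w x‖ := norm_pos_iff.mpr (hw0 x)
    have hpt : ∀ r : Ioi (0 : ℝ), (radialExt w ⁻¹' U).indicator
        (fun z => ENNReal.ofReal |(fderiv ℝ (radialExt w) z).det|) ((r : ℝ) • (x : Euc n)) ≤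
        (Iio (⟨4 * R / ‖w x‖, mem_Ioi.mpr (by positivity)⟩ : Ioi (0 : ℝ))).indicator
          (fun _ => {x : Sph n | w x ∈ C}.indicator
            (fun x => ENNReal.ofReal |(fderiv ℝ (radialExt w) x).det|) x) r := fun r => by
      have hr : (0 : ℝ) < r := r.2
      by_cases hz : (r : ℝ) • (x : Euc n) ∈ radialExt w ⁻¹' U
      · rw [indicator_of_mem hz, fderiv_radialExt_smul w hr]
        rw [mem_preimage, radialExt_smul hr, radialExt_coe] at hz
        have h1 : w x ∈ C := by
          have := hC (r : ℝ)⁻¹ (inv_pos.mpr hr) _ hz.1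
          rwa [smul_smul, inv_mul_cancel₀ hr.ne', one_smul] at this
        have h2 : (r : ℝ) < 4 * R / ‖w x‖ := by
          have := hz.2.2
          rw [norm_smul, Real.norm_of_nonneg hr.le] at this
          rwa [lt_div_iff₀ hwx]
        rw [indicator_of_mem (show r ∈ Iio (⟨4 * R / ‖w x‖,
            mem_Ioi.mpr (by positivity)⟩ : Ioi (0 : ℝ)) from h2),
          indicator_of_mem (show x ∈ {x : Sph n | w x ∈ C} from h1)]
      · rw [indicator_of_notMem hz]; exact zero_le
    refine (lintegral_mono hpt).trans ?_
    rw [lintegral_indicator_const measurableSet_Iio, Measure.volumeIoiPow_apply_Iio,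
      Nat.sub_add_cancel hn]
    by_cases hx : x ∈ {x : Sph n | w x ∈ C}
    · rw [indicator_of_mem hx, indicator_of_mem hx, mul_assoc]
      refine le_of_eq ?_
      congr 1
      have hcast : ((n - 1 : ℕ) : ℝ) + 1 = n := by rw [Nat.cast_sub hn]; simp
      rw [hcast, ← ofReal_norm, ← ENNReal.ofReal_inv_of_pos hwx,
        ← ENNReal.ofReal_pow (by positivity), ← ENNReal.ofReal_mul (by positivity), div_pow,
        inv_pow]
      congr 1
      field_simp
    · simp [hx]
  have hfinal := (mul_le_mul_right hvol (ENNReal.ofReal |(d : ℝ)|)).trans (key.trans hint)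
  have hq : ENNReal.ofReal ((4 * R) ^ n / n) = 4 ^ n * ENNReal.ofReal (R ^ n / n) := by
    rw [mul_pow, mul_div_assoc, ENNReal.ofReal_mul (by positivity),
      ENNReal.ofReal_pow (by norm_num)]
    norm_num
  rw [hq, ← mul_assoc, ← mul_assoc] at hfinal
  rw [mul_comm (4 ^ n)]
  exact (ENNReal.mul_le_mul_iff_left
    (ENNReal.ofReal_pos.mpr (by positivity)).ne' ENNReal.ofReal_ne_top).mp hfinal

end ConeEstimate

/-! ### The cone estimate for continuous Sobolev maps -/

section SobolevDegree

variable {n : ℕ}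

/-- A compact part of an open cone has an open conical neighbourhood that stays in the cone under
small perturbations away from the origin. -/
theorem IsCone.exists_smaller_cone {C : Set (Euc n)} (hCo : IsOpen C) (hC : IsCone C)
    {K : Set (Sph n)} (hK : IsCompact K) (hKC : ∀ x ∈ K, (x : Euc n) ∈ C) :
    ∃ C' : Set (Euc n), IsOpen C' ∧ IsCone C' ∧ (∀ x ∈ K, (x : Euc n) ∈ C') ∧
      ∃ ε : ℝ, 0 < ε ∧ ∀ z ∈ C', 1 / 4 ≤ ‖z‖ → ∀ z', ‖z' - z‖ ≤ ε → z' ∈ C := by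
  obtain ⟨η, hη, hηC⟩ := (hK.image continuous_subtype_val).exists_thickening_subset_open hCo
    (by rintro _ ⟨x, hx, rfl⟩; exact hKC x hx)
  -- The cone generated by a thickening of `K`. If `t z` lies in the thickening and `|z| ≥ 1/4`,
  -- then `t ≤ 4 (1 + η)`, so an error `η / (8 (1 + η))` in `z` moves `t z` by at most `η / 2`.
  refine ⟨⋃ t ∈ Ioi (0 : ℝ), (fun z : Euc n => t • z) ⁻¹' thickening (η / 2) (Subtype.val '' K),
    isOpen_biUnion fun t _ => isOpen_thickening.preimage (continuous_const_smul t), ?_, ?_,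
    η / (8 * (1 + η)), by positivity, ?_⟩
  · intro s hs z hz
    simp only [mem_iUnion, mem_preimage, mem_Ioi, exists_prop] at hz ⊢
    obtain ⟨t, ht, hz⟩ := hz
    refine ⟨t / s, div_pos ht hs, ?_⟩
    rwa [smul_smul, div_mul_cancel₀ _ hs.ne']
  · intro x hx
    simp only [mem_iUnion, mem_preimage, mem_Ioi, exists_prop]
    refine ⟨1, one_pos, ?_⟩
    rw [one_smul]
    exact self_subset_thickening (by positivity) _ ⟨x, hx, rfl⟩
  · intro z hz hz4 z' hz'
    simp only [mem_iUnion, mem_preimage, mem_Ioi, exists_prop] at hz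
    obtain ⟨t, ht, hz⟩ := hz
    obtain ⟨_, ⟨u, hu, rfl⟩, hd⟩ := mem_thickening_iff.mp hz
    have h1 : ‖t • z‖ < 1 + η / 2 := by
      have := norm_le_norm_add_norm_sub' (t • z) (u : Euc n)
      rw [norm_coe_sph] at this
      rw [dist_eq_norm] at hd
      linarith
    rw [norm_smul, Real.norm_of_nonneg ht.le] at h1
    have h2 : t ≤ 4 * (1 + η) := by nlinarith
    have h3 : t * ‖z' - z‖ ≤ η / 2 := by
      calc t * ‖z' - z‖ ≤ (4 * (1 + η)) * (η / (8 * (1 + η))) := by gcongr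
        _ = η / 2 := by field_simp; norm_num
    have h4 : t • z' ∈ C := by
      refine hηC (mem_thickening_iff.mpr ⟨u, ⟨u, hu, rfl⟩, ?_⟩)
      calc dist (t • z') (u : Euc n) ≤ dist (t • z') (t • z) + dist (t • z) u := dist_triangle _ _ _
        _ < η / 2 + η / 2 := by
          refine add_lt_add_of_le_of_lt ?_ hd
          rw [dist_eq_norm, ← smul_sub, norm_smul, Real.norm_of_nonneg ht.le]
          exact h3
        _ = η := by ring
    have := hC t⁻¹ (inv_pos.mpr ht) _ h4
    rwa [smul_smul, inv_mul_cancel₀ ht.ne', one_smul] at this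

theorem exists_zonal_mollifier (hn : 1 ≤ n) {δ : ℝ} (hδ : 0 < δ) :
    ∃ k : ℝ → ℝ, ContDiff ℝ ∞ k ∧ (∀ t, 0 ≤ k t) ∧
      (∀ x : Sph n, ∫ y : Sph n, k (inner ℝ (x : Euc n) (y : Euc n)) ∂(sphMeasure n) = 1) ∧
      ∀ x y : Sph n, k (inner ℝ (x : Euc n) (y : Euc n)) ≠ 0 → dist x y < δ := by
  have := isFiniteMeasure_sphMeasure hn
  have := isOpenPosMeasure_sphMeasure hn
  obtain ⟨x₀⟩ := nonempty_sph hn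
  set κ := ∫ y : Sph n, zonalBump (δ ^ 2 / 2) (inner ℝ (x₀ : Euc n) (y : Euc n)) ∂(sphMeasure n)
    with hκ
  have hκpos : 0 < κ := integral_zonalBump_pos (by positivity) x₀
  refine ⟨fun t => κ⁻¹ * zonalBump (δ ^ 2 / 2) t, contDiff_const.mul (contDiff_zonalBump _),
    fun t => mul_nonneg (by positivity) (zonalBump_nonneg _ _), fun x => ?_, fun x y h => ?_⟩
  · rw [integral_const_mul,
      isRotationInvariant_sphMeasure.integral_zonal (zonalBump (δ ^ 2 / 2)) x x₀, ← hκ,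
      inv_mul_cancel₀ hκpos.ne']
  · exact dist_lt_of_zonalBump_ne_zero (right_ne_zero_of_mul h) hδ

/-- The `C¹` estimate is applied to an average of `f - p` and to a smaller cone, so that every `y`
seen by the kernel from a point `x` with `w x` in the smaller cone has `f y - p ∈ C`. A single fine
enough average suffices; no limit is taken. -/
theorem IsBrouwerDegree.mul_sphMeasure_compact_le (hn : 2 ≤ n) {f : C(Sph n, Euc n)}
    {A : Sph n → Euc n →L[ℝ] Euc n} (hA : IsWeakDeriv f A) {p : Euc n} {hp : ∀ x, f x ≠ p}
    (hfp : ∀ x, 1 / 2 ≤ ‖f x - p‖) {d : ℤ} (hd : IsBrouwerDegree (normalizedMap f p hp) d)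
    {C : Set (Euc n)} (hCo : IsOpen C) (hC : IsCone C) {K : Set (Sph n)} (hK : IsCompact K)
    (hKC : ∀ x ∈ K, (x : Euc n) ∈ C) :
    ENNReal.ofReal |(d : ℝ)| * sphMeasure n K ≤
      4 ^ n * ∫⁻ y in {y : Sph n | f y - p ∈ C},
        2 ^ (n - 1) * (‖A y‖ₑ ^ (n - 1) * (‖f y - p‖ₑ⁻¹) ^ (n - 1)) ∂(sphMeasure n) := by
  have hn1 : 1 ≤ n := by omega
  have hfin := isFiniteMeasure_sphMeasure hn1
  obtain ⟨C', hC'o, hC', hKC', ε₀, hε₀, hpert⟩ := hC.exists_smaller_cone hCo hK hKC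
  -- The bound `1/4`, half the distance from `p` to the image, yields `|w| ≥ 1/4` and `|f y - p| ≤ 2
  -- |w x|`, the source of the factor `2^(n-1)`.
  set ε := min ε₀ (1 / 4) with hε
  have hεpos : 0 < ε := lt_min hε₀ (by norm_num)
  obtain ⟨δ, hδ, hfδ⟩ := Metric.uniformContinuous_iff.mp
    (CompactSpace.uniformContinuous_of_continuous f.continuous) (ε / 2) (by positivity)
  obtain ⟨k, hk, hk0, hk1, hkδ⟩ := exists_zonal_mollifier hn1 hδ
  let w : Euc n → Euc n := fun x => sphMollify k f x - p
  have hw : ContDiff ℝ 1 w := (contDiff_sphMollify hk f).sub contDiff_const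
  have hclose : ∀ x : Sph n, ‖w x - (f x - p)‖ ≤ ε / 2 := fun x => by
    simp only [w, sub_sub_sub_cancel_right]
    refine norm_sphMollify_sub_le hk hk0 (hk1 x) fun y hy => ?_
    rw [← dist_eq_norm, dist_comm]
    exact (hfδ (hkδ x y hy)).le
  have hclose2 : ∀ x y : Sph n, k (inner ℝ (x : Euc n) (y : Euc n)) ≠ 0 →
      ‖(f y - p) - w x‖ ≤ ε := fun x y hxy => by
    have h1 := hclose x
    have h2 := (hfδ (hkδ x y hxy)).le
    rw [dist_eq_norm] at h2
    calc ‖(f y - p) - w x‖ = ‖(w x - (f x - p)) + (f x - f y)‖ := by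
          rw [← norm_neg]; congr 1; abel
      _ ≤ ε / 2 + ε / 2 := (norm_add_le _ _).trans (add_le_add h1 h2)
      _ = ε := by ring
  have hε4 : ε ≤ 1 / 4 := min_le_right _ _
  have hwlow : ∀ x : Sph n, 1 / 4 ≤ ‖w x‖ := fun x => by
    have h1 := hclose x
    have h2 := norm_sub_norm_le (f x - p) (w x)
    rw [norm_sub_rev (f x - p) (w x)] at h2
    linarith [hfp x]
  have hwf : ∀ x : Sph n, ‖w x - (f x - p)‖ < ‖f x - p‖ := fun x => by
    linarith [hclose x, hfp x]
  have key := hd.mul_toSphere_le hn1 hw hwf hC'o hC' hK hKC'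
  obtain ⟨c, -, -, hc⟩ := exists_sphMeasure_eq_smul_toSphere hn1
  have key2 : ENNReal.ofReal |(d : ℝ)| * sphMeasure n K ≤
      4 ^ n * ∫⁻ x in {x : Sph n | w x ∈ C'}, ENNReal.ofReal |(fderiv ℝ (radialExt w) x).det| *
        (‖w x‖ₑ⁻¹) ^ n ∂(sphMeasure n) := by
    rw [hc, Measure.restrict_smul, lintegral_smul_measure, Measure.smul_apply, smul_eq_mul,
      smul_eq_mul, mul_left_comm, mul_left_comm (4 ^ n)]
    gcongr
  refine key2.trans ?_
  gcongr 4 ^ n * ?_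
  let kk : Sph n → Sph n → ENNReal := fun x y =>
    ENNReal.ofReal (k (inner ℝ (x : Euc n) (y : Euc n)))
  have hkkc : Continuous fun q : Sph n × Sph n => kk q.1 q.2 :=
    ENNReal.continuous_ofReal.comp (hk.continuous.comp (by fun_prop))
  have hkk1 : ∀ x, ∫⁻ y, kk x y ∂(sphMeasure n) = 1 := fun x => by
    have hci : Continuous fun y : Sph n => k (inner ℝ (x : Euc n) (y : Euc n)) :=
      hk.continuous.comp (by fun_prop)
    rw [← ofReal_integral_eq_lintegral_ofReal
      (hci.integrable_of_hasCompactSupport (HasCompactSupport.of_compactSpace _))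
      (Eventually.of_forall fun y => hk0 _), hk1, ENNReal.ofReal_one]
  have hAm : AEStronglyMeasurable A (sphMeasure n) := hA.integrable.aestronglyMeasurable
  have hjac : ∀ x : Sph n, ENNReal.ofReal |(fderiv ℝ (radialExt w) x).det| * (‖w x‖ₑ⁻¹) ^ n ≤
      ∫⁻ y, kk x y * ‖A y‖ₑ ^ (n - 1) * (‖w x‖ₑ⁻¹) ^ (n - 1) ∂(sphMeasure n) := fun x => by
    have h1 := ofReal_abs_det_fderiv_radialExt_le hn1 hw (norm_coe_sph x)
      (a := ∫⁻ y, kk x y * ‖A y‖ₑ ∂(sphMeasure n)) fun v hv hxv => by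
        have hfd : fderiv ℝ w (x : Euc n) = fderiv ℝ (sphMollify k f) x := fderiv_sub_const p
        rw [hfd]
        exact hA.enorm_fderiv_sphMollify_le hk hk0 (norm_coe_sph x) hv hxv
    have h2 := lintegral_mul_pow_le (hkkc.comp (Continuous.prodMk_right x)).measurable (hkk1 x) hAm
      (p := n - 1) (by omega)
    have hw0 : ‖w x‖ₑ ≠ 0 := by
      rw [Ne, enorm_eq_zero, ← norm_eq_zero]; linarith [hwlow x]
    have hpow : (‖w x‖ₑ⁻¹) ^ n = ‖w x‖ₑ⁻¹ * (‖w x‖ₑ⁻¹) ^ (n - 1) := by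
      rw [← pow_succ', Nat.sub_add_cancel hn1]
    have hfinw : (‖w x‖ₑ⁻¹) ^ (n - 1) ≠ ⊤ := ENNReal.pow_ne_top (ENNReal.inv_ne_top.mpr hw0)
    rw [lintegral_mul_const' _ _ hfinw, hpow]
    calc _ ≤ (‖w x‖ₑ * (∫⁻ y, kk x y * ‖A y‖ₑ ∂(sphMeasure n)) ^ (n - 1)) *
          (‖w x‖ₑ⁻¹ * (‖w x‖ₑ⁻¹) ^ (n - 1)) := by gcongr
      _ = (‖w x‖ₑ * ‖w x‖ₑ⁻¹) * ((∫⁻ y, kk x y * ‖A y‖ₑ ∂(sphMeasure n)) ^ (n - 1) *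
          (‖w x‖ₑ⁻¹) ^ (n - 1)) := by ring
      _ ≤ _ := by
        rw [ENNReal.mul_inv_cancel hw0 enorm_ne_top, one_mul]
        gcongr
        exact h2
  refine (lintegral_mono fun x => hjac x).trans ?_
  have hmeas : AEMeasurable (Function.uncurry fun x y : Sph n =>
      kk x y * ‖A y‖ₑ ^ (n - 1) * (‖w x‖ₑ⁻¹) ^ (n - 1))
      (((sphMeasure n).restrict {x : Sph n | w x ∈ C'}).prod (sphMeasure n)) := by
    refine (hkkc.measurable.aemeasurable.mul ((hAm.comp_snd.enorm).pow_const _)).mul ?_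
    have : Continuous fun q : Sph n × Sph n => w q.1 :=
      hw.continuous.comp (continuous_subtype_val.comp continuous_fst)
    exact (this.measurable.enorm.inv.pow_const _).aemeasurable
  rw [lintegral_lintegral_swap hmeas]
  have hBm : MeasurableSet {y : Sph n | f y - p ∈ C} :=
    (f.continuous.sub continuous_const).measurable hCo.measurableSet
  have hC'm : MeasurableSet {x : Sph n | w x ∈ C'} :=
    (hw.continuous.comp continuous_subtype_val).measurable hC'o.measurableSet
  rw [← lintegral_indicator hBm]
  refine lintegral_mono fun y => ?_
  set b : ENNReal := {y : Sph n | f y - p ∈ C}.indicator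
    (fun y => 2 ^ (n - 1) * (‖A y‖ₑ ^ (n - 1) * (‖f y - p‖ₑ⁻¹) ^ (n - 1))) y with hb
  -- Where the kernel is nonzero, every factor depending on `x` is bounded by one depending on `y`
  -- alone. The symmetric kernel then integrates to `1` in `x`.
  have hpt : ∀ x ∈ {x : Sph n | w x ∈ C'},
      kk x y * ‖A y‖ₑ ^ (n - 1) * (‖w x‖ₑ⁻¹) ^ (n - 1) ≤ kk y x * b := fun x hx => by
    have hsymm : kk x y = kk y x := by simp only [kk, real_inner_comm]
    by_cases hxy : k (inner ℝ (x : Euc n) (y : Euc n)) = 0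
    · simp [kk, hxy]
    · have h1 := hclose2 x y hxy
      have hmem : y ∈ {y : Sph n | f y - p ∈ C} :=
        hpert (w x) hx (hwlow x) _ (h1.trans (min_le_left _ _))
      rw [hb, indicator_of_mem hmem, hsymm, mul_assoc, mul_left_comm (2 ^ (n - 1))]
      gcongr kk y x * (‖A y‖ₑ ^ (n - 1) * ?_)
      rw [← mul_pow]
      refine pow_le_pow_left' ?_ _
      have hpos1 : 0 < ‖w x‖ := by linarith [hwlow x]
      have hpos2 : 0 < ‖f y - p‖ := by linarith [hfp y]
      have h22 : (2 : ENNReal) * ENNReal.ofReal ‖f y - p‖⁻¹ =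
          ENNReal.ofReal (2 * ‖f y - p‖⁻¹) := by
        rw [ENNReal.ofReal_mul (by norm_num)]; simp
      rw [← ofReal_norm, ← ofReal_norm, ← ENNReal.ofReal_inv_of_pos hpos1,
        ← ENNReal.ofReal_inv_of_pos hpos2, h22]
      refine ENNReal.ofReal_le_ofReal ?_
      rw [← div_eq_mul_inv, inv_le_comm₀ hpos1 (by positivity), inv_div]
      have h2 := norm_sub_norm_le (f y - p) (w x)
      linarith [hfp y]
  calc ∫⁻ x in {x : Sph n | w x ∈ C'},
        kk x y * ‖A y‖ₑ ^ (n - 1) * (‖w x‖ₑ⁻¹) ^ (n - 1) ∂(sphMeasure n)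
      ≤ ∫⁻ x in {x : Sph n | w x ∈ C'}, kk y x * b ∂(sphMeasure n) :=
        setLIntegral_mono' hC'm hpt
    _ ≤ ∫⁻ x, kk y x * b ∂(sphMeasure n) := setLIntegral_le_lintegral _ _
    _ = b := by
        rw [lintegral_mul_const _ (show Measurable fun x => kk y x from
          (hkkc.comp (Continuous.prodMk_right y)).measurable), hkk1, one_mul]

/-- The degree with respect to `p` of a continuous Sobolev map is controlled by the energy density
over the preimage of a translated cone. -/
theorem IsBrouwerDegree.mul_sphMeasure_le (hn : 2 ≤ n) {f : C(Sph n, Euc n)}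
    {A : Sph n → Euc n →L[ℝ] Euc n} (hA : IsWeakDeriv f A) {p : Euc n} {hp : ∀ x, f x ≠ p}
    (hfp : ∀ x, 1 / 2 ≤ ‖f x - p‖) {d : ℤ} (hd : IsBrouwerDegree (normalizedMap f p hp) d)
    {C : Set (Euc n)} (hCo : IsOpen C) (hC : IsCone C) :
    ENNReal.ofReal |(d : ℝ)| * sphMeasure n {x : Sph n | (x : Euc n) ∈ C} ≤
      4 ^ n * ∫⁻ y in {y : Sph n | f y - p ∈ C},
        2 ^ (n - 1) * (‖A y‖ₑ ^ (n - 1) * (‖f y - p‖ₑ⁻¹) ^ (n - 1)) ∂(sphMeasure n) := by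
  have hfin := isFiniteMeasure_sphMeasure (n := n) (by omega)
  have hopen : IsOpen {x : Sph n | (x : Euc n) ∈ C} := hCo.preimage continuous_subtype_val
  -- The right side does not depend on the compact set, so inner regularity gives the whole open
  -- set.
  rw [hopen.measure_eq_iSup_isCompact]
  simp only [ENNReal.mul_iSup]
  exact iSup_le fun K => iSup_le fun hKC => iSup_le fun hK =>
    hd.mul_sphMeasure_compact_le hn hA hfp hCo hC hK fun x hx => hKC hx

end SobolevDegree

/-! ### Lattice points near a given point -/

/-- A ball of radius `r ≥ 1/2` contains at most `(4r)ⁿ` points of the lattice `ℤⁿ`. -/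
theorem card_le_of_norm_sub_latticePoint_le {n : ℕ} (S : Finset (Fin n → ℤ)) (z : Euc n) {r : ℝ}
    (hr : 1 / 2 ≤ r) (h : ∀ σ ∈ S, ‖z - latticePoint σ‖ ≤ r) : (S.card : ℝ) ≤ (4 * r) ^ n := by
  classical
  have hsub : S ⊆ Fintype.piFinset fun i => Finset.Icc ⌈z i - r⌉ ⌊z i + r⌋ := fun σ hσ => by
    refine Fintype.mem_piFinset.mpr fun i => ?_
    have h1 : |z i - σ i| ≤ r := by
      have := PiLp.norm_apply_le (z - latticePoint σ) i
      simp only [latticePoint, PiLp.sub_apply, Real.norm_eq_abs] at this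
      exact this.trans (h σ hσ)
    rw [abs_le] at h1
    rw [Finset.mem_Icc, Int.ceil_le, Int.le_floor]
    constructor <;> linarith
  calc (S.card : ℝ) ≤ ((Fintype.piFinset fun i => Finset.Icc ⌈z i - r⌉ ⌊z i + r⌋).card : ℝ) := by
        exact_mod_cast Finset.card_le_card hsub
    _ = ∏ i : Fin n, ((Finset.Icc ⌈z i - r⌉ ⌊z i + r⌋).card : ℝ) := by
        rw [Fintype.card_piFinset]; push_cast; rfl
    _ ≤ ∏ _i : Fin n, (4 * r) := by
        refine Finset.prod_le_prod (fun _ _ => by positivity) fun i _ => ?_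
        -- An interval of length `2r` contains at most `2r + 1` integers, and `2r + 1 ≤ 4r` because
        -- `r ≥ 1/2`.
        rw [Int.card_Icc]
        have h0 : ((⌊z i + r⌋ + 1 - ⌈z i - r⌉).toNat : ℝ) =
            ((max (⌊z i + r⌋ + 1 - ⌈z i - r⌉) 0 : ℤ) : ℝ) := by
          rw [← Int.ofNat_toNat, Int.cast_natCast]
        rw [h0]
        push_cast
        refine max_le ?_ (by linarith)
        linarith [Int.floor_le (z i + r), Int.le_ceil (z i - r)]
    _ = (4 * r) ^ n := by simp

/-- The sum of `|z - σ|^{-(n-1)}` over `N` lattice points `σ` is at most of order `N^{1/n}`. -/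
theorem sum_inv_norm_sub_latticePoint_pow_le {n : ℕ} (hn : 1 ≤ n) (z : Euc n) :
    ∀ S : Finset (Fin n → ℤ), (∀ σ ∈ S, 1 / 2 ≤ ‖z - latticePoint σ‖) →
      ∑ σ ∈ S, (‖z - latticePoint σ‖⁻¹) ^ (n - 1) ≤
        n * 4 ^ (n - 1) * (S.card : ℝ) ^ (1 / (n : ℝ)) := by
  classical
  have hn0 : (0 : ℝ) < n := by exact_mod_cast hn
  intro S
  induction hN : S.card generalizing S with
  | zero =>
    intro _
    rw [Finset.card_eq_zero] at hN
    subst hN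
    simp only [Finset.sum_empty]
    positivity
  | succ N ih =>
    intro hS
    have hne : S.Nonempty := by rw [← Finset.card_pos]; omega
    -- The farthest point is removed. All `M` points lie within its distance `r`, so `M ≤ (4r)ⁿ` and
    -- its term is at most `4^(n-1) M^(1/n - 1)`.
    obtain ⟨τ, hτ, hmax⟩ := S.exists_max_image (fun σ => ‖z - latticePoint σ‖) hne
    have hcard : (S.erase τ).card = N := by rw [Finset.card_erase_of_mem hτ]; omega
    have h1 := ih (S.erase τ) hcard fun σ hσ => hS σ (Finset.mem_of_mem_erase hσ)
    rw [← Finset.add_sum_erase S _ hτ]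
    set r := ‖z - latticePoint τ‖ with hr
    have hr2 : 1 / 2 ≤ r := hS τ hτ
    have hr0 : 0 < r := by linarith
    have h2 := card_le_of_norm_sub_latticePoint_le S z hr2 hmax
    rw [hN] at h2
    set M : ℝ := ((N + 1 : ℕ) : ℝ) with hM
    have hM1 : 1 ≤ M := by rw [hM]; push_cast; linarith [(Nat.cast_nonneg N : (0 : ℝ) ≤ N)]
    have hM0 : 0 < M := by linarith
    have hNM : (N : ℝ) = M - 1 := by rw [hM]; push_cast; ring
    set t := M ^ (1 / (n : ℝ)) with ht
    have ht0 : 0 < t := Real.rpow_pos_of_pos hM0 _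
    have htn : t ^ n = M := by
      rw [ht, ← Real.rpow_natCast, ← Real.rpow_mul hM0.le, one_div,
        inv_mul_cancel₀ hn0.ne', Real.rpow_one]
    have htr : t ≤ 4 * r := by
      by_contra! hlt
      have := pow_lt_pow_left₀ hlt (by positivity) (by omega : n ≠ 0)
      linarith
    have hterm : (r⁻¹) ^ (n - 1) ≤ 4 ^ (n - 1) * (t / M) := by
      have h3 : r⁻¹ ≤ 4 * t⁻¹ := by
        rw [← div_eq_mul_inv, inv_le_comm₀ hr0 (by positivity), inv_div]; linarith
      have h4 : (t⁻¹) ^ (n - 1) = t / M := by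
        rw [← htn, inv_pow, eq_div_iff (by positivity), inv_mul_eq_iff_eq_mul₀ (by positivity),
          ← pow_succ, Nat.sub_add_cancel hn]
      rw [← h4, ← mul_pow]
      exact pow_le_pow_left₀ (by positivity) h3 _
    -- By Bernoulli's inequality, `n M^(1/n)` grows by at least `M^(1/n - 1)` from `M - 1` to `M`,
    -- which absorbs the removed term.
    have hbern : (N : ℝ) ^ (1 / (n : ℝ)) ≤ t * (1 - 1 / (n * M)) := by
      have h5 : (N : ℝ) = M * (1 + -(1 / M)) := by rw [hNM]; field_simp; ring
      have h6 : -1 ≤ -(1 / M) := by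
        rw [neg_le_neg_iff, div_le_one hM0]; exact hM1
      rw [h5, Real.mul_rpow hM0.le (by linarith)]
      refine mul_le_mul_of_nonneg_left ?_ ht0.le
      have h7 := rpow_one_add_le_one_add_mul_self h6 (p := 1 / (n : ℝ)) (by positivity)
        (by rw [div_le_one hn0]; exact_mod_cast hn)
      refine h7.trans (le_of_eq ?_)
      field_simp
      ring
    calc _ ≤ 4 ^ (n - 1) * (t / M) + n * 4 ^ (n - 1) * (t * (1 - 1 / (n * M))) := by
          refine add_le_add hterm (h1.trans ?_)
          gcongr
      _ = n * 4 ^ (n - 1) * t := by field_simp; ring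

/-! ### Summation over the lattice points and conclusion -/

theorem norm_sub_latticePoint_ge {n : ℕ} {f : C(Sph n, Euc n)} {S : Finset (Fin n → ℤ)}
    (hfS : ∀ x, ∀ σ ∈ S, f x ∉ ball (latticePoint σ) (1 / 2)) {σ : Fin n → ℤ} (hσ : σ ∈ S)
    (x : Sph n) : 1 / 2 ≤ ‖f x - latticePoint σ‖ := by
  have h := hfS x σ hσ
  rwa [mem_ball, not_lt, dist_eq_norm] at h

/-- The cone estimate for the degree `deg_p f`. -/
theorem IsWeakDeriv.degAt_mul_sphMeasure_le {n : ℕ} (hn : 2 ≤ n) {f : C(Sph n, Euc n)}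
    {A : Sph n → Euc n →L[ℝ] Euc n} (hA : IsWeakDeriv f A) {p : Euc n}
    (hfp : ∀ x, 1 / 2 ≤ ‖f x - p‖) {C : Set (Euc n)} (hCo : IsOpen C) (hC : IsCone C) :
    ENNReal.ofReal |(degAt p f : ℝ)| * sphMeasure n {x : Sph n | (x : Euc n) ∈ C} ≤
      4 ^ n * ∫⁻ y in {y : Sph n | f y - p ∈ C},
        2 ^ (n - 1) * (‖A y‖ₑ ^ (n - 1) * (‖f y - p‖ₑ⁻¹) ^ (n - 1)) ∂(sphMeasure n) := by
  have hp : ∀ x, f x ≠ p := fun x hx => by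
    have := hfp x
    rw [hx, sub_self, norm_zero] at this
    norm_num at this
  rw [degAt, dif_pos hp, brouwerDegree]
  -- Any integer chosen by the definition obeys the bound. The default value `0` satisfies it
  -- trivially.
  split_ifs with h
  · exact h.choose_spec.mul_sphMeasure_le hn hA hfp hCo hC
  · simp

/-- The summed cone estimate, in extended nonnegative reals. -/
theorem IsWeakDeriv.sum_degAt_mul_sphMeasure_le {n : ℕ} (hn : 2 ≤ n) {f : C(Sph n, Euc n)}
    {A : Sph n → Euc n →L[ℝ] Euc n} (hA : IsWeakDeriv f A) {S : Finset (Fin n → ℤ)}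
    (hfS : ∀ x, ∀ σ ∈ S, f x ∉ ball (latticePoint σ) (1 / 2))
    {C : Set (Euc n)} (hCo : IsOpen C) (hC : IsCone C) :
    ENNReal.ofReal (∑ σ ∈ S, |(degAt (latticePoint σ) f : ℝ)|) *
        sphMeasure n {x : Sph n | (x : Euc n) ∈ C} ≤
      ENNReal.ofReal (4 ^ n * 2 ^ (n - 1) * (n * 4 ^ (n - 1)) *
        (∑ σ ∈ S, |(degAt (latticePoint σ) f : ℝ)|) ^ (1 / (n : ℝ))) *
      ∫⁻ y in f ⁻¹' (C + latticePoint '' (S : Set (Fin n → ℤ))),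
        ‖A y‖ₑ ^ (n - 1) ∂(sphMeasure n) := by
  classical
  set D := ∑ σ ∈ S, |(degAt (latticePoint σ) f : ℝ)| with hD
  -- Each point kept contributes at least `1` to `D`, so their number is at most `D`, whatever the
  -- size of `S`.
  set T := S.filter fun σ => degAt (latticePoint σ) f ≠ 0 with hT
  set E := f ⁻¹' (C + latticePoint '' (S : Set (Fin n → ℤ))) with hE
  have hDT : D = ∑ σ ∈ T, |(degAt (latticePoint σ) f : ℝ)| := by
    rw [hD, hT, Finset.sum_filter_of_ne]
    intro σ _ h0 h1
    simp [h1] at h0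
  have hcard : (T.card : ℝ) ≤ D := by
    rw [hDT, Finset.card_eq_sum_ones, Nat.cast_sum]
    refine Finset.sum_le_sum fun σ hσ => ?_
    have h1 : (1 : ℤ) ≤ |degAt (latticePoint σ) f| :=
      Int.one_le_abs (Finset.mem_filter.mp hσ).2
    exact_mod_cast h1
  have hEo : IsOpen E := (hCo.add_right).preimage f.continuous
  have hAm : AEStronglyMeasurable A (sphMeasure n) := hA.integrable.aestronglyMeasurable
  have hTS : ∀ σ ∈ T, σ ∈ S := fun σ hσ => (Finset.mem_filter.mp hσ).1
  have hone : ∀ σ ∈ T, ENNReal.ofReal |(degAt (latticePoint σ) f : ℝ)| *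
      sphMeasure n {x : Sph n | (x : Euc n) ∈ C} ≤
      4 ^ n * ∫⁻ y in E, 2 ^ (n - 1) * (‖A y‖ₑ ^ (n - 1) *
        (‖f y - latticePoint σ‖ₑ⁻¹) ^ (n - 1)) ∂(sphMeasure n) := fun σ hσ => by
    refine (hA.degAt_mul_sphMeasure_le hn
      (norm_sub_latticePoint_ge hfS (hTS σ hσ)) hCo hC).trans ?_
    gcongr
    intro y hy
    exact Set.mem_add.mpr ⟨f y - latticePoint σ, hy, latticePoint σ,
      mem_image_of_mem _ (hTS σ hσ), sub_add_cancel _ _⟩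
  calc ENNReal.ofReal D * sphMeasure n {x : Sph n | (x : Euc n) ∈ C}
      = ∑ σ ∈ T, ENNReal.ofReal |(degAt (latticePoint σ) f : ℝ)| *
          sphMeasure n {x : Sph n | (x : Euc n) ∈ C} := by
        rw [hDT, ENNReal.ofReal_sum_of_nonneg fun _ _ => abs_nonneg _, Finset.sum_mul]
    _ ≤ ∑ σ ∈ T, 4 ^ n * ∫⁻ y in E, 2 ^ (n - 1) * (‖A y‖ₑ ^ (n - 1) *
        (‖f y - latticePoint σ‖ₑ⁻¹) ^ (n - 1)) ∂(sphMeasure n) := Finset.sum_le_sum hone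
    _ = 4 ^ n * ∫⁻ y in E, ∑ σ ∈ T, 2 ^ (n - 1) * (‖A y‖ₑ ^ (n - 1) *
        (‖f y - latticePoint σ‖ₑ⁻¹) ^ (n - 1)) ∂(sphMeasure n) := by
        rw [← Finset.mul_sum, lintegral_finsetSum']
        intro σ _
        refine AEMeasurable.const_mul ((hAm.restrict.enorm.pow_const _).mul ?_) _
        have : Continuous fun y : Sph n => f y - latticePoint σ :=
          f.continuous.sub continuous_const
        exact (this.measurable.enorm.inv.pow_const _).aemeasurable
    _ ≤ 4 ^ n * ∫⁻ y in E, ENNReal.ofReal (2 ^ (n - 1) * (n * 4 ^ (n - 1) * D ^ (1 / (n : ℝ)))) *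
        ‖A y‖ₑ ^ (n - 1) ∂(sphMeasure n) := by
        gcongr with y
        have h1 := sum_inv_norm_sub_latticePoint_pow_le (by omega : 1 ≤ n) (f y) T fun σ hσ =>
          norm_sub_latticePoint_ge hfS (hTS σ hσ) y
        have h2 : ∑ σ ∈ T, (‖f y - latticePoint σ‖ₑ⁻¹) ^ (n - 1) ≤
            ENNReal.ofReal (n * 4 ^ (n - 1) * D ^ (1 / (n : ℝ))) := by
          have h3 : ∀ σ ∈ T, (‖f y - latticePoint σ‖ₑ⁻¹) ^ (n - 1) =
              ENNReal.ofReal ((‖f y - latticePoint σ‖⁻¹) ^ (n - 1)) := fun σ hσ => by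
            have hpos : 0 < ‖f y - latticePoint σ‖ := by
              linarith [norm_sub_latticePoint_ge hfS (hTS σ hσ) y]
            rw [← ofReal_norm, ← ENNReal.ofReal_inv_of_pos hpos,
              ENNReal.ofReal_pow (by positivity)]
          rw [Finset.sum_congr rfl h3, ← ENNReal.ofReal_sum_of_nonneg fun _ _ => by positivity]
          refine ENNReal.ofReal_le_ofReal (h1.trans ?_)
          gcongr
        calc ∑ σ ∈ T, 2 ^ (n - 1) * (‖A y‖ₑ ^ (n - 1) * (‖f y - latticePoint σ‖ₑ⁻¹) ^ (n - 1))
            = 2 ^ (n - 1) * (∑ σ ∈ T, (‖f y - latticePoint σ‖ₑ⁻¹) ^ (n - 1)) *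
                ‖A y‖ₑ ^ (n - 1) := by
              rw [Finset.mul_sum, Finset.sum_mul]
              exact Finset.sum_congr rfl fun _ _ => by ring
          _ ≤ _ := by
              rw [ENNReal.ofReal_mul (by positivity), ENNReal.ofReal_pow (by norm_num)]
              gcongr
              simp
    _ = _ := by
        rw [lintegral_const_mul' _ _ ENNReal.ofReal_ne_top, ← mul_assoc]
        congr 1
        rw [show (4 : ENNReal) ^ n = ENNReal.ofReal (4 ^ n) by
          rw [ENNReal.ofReal_pow (by norm_num)]; simp, ← ENNReal.ofReal_mul (by positivity)]
        congr 1
        ring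

theorem sphMeasure_cone_pos {n : ℕ} (hn : 2 ≤ n) {C : Set (Euc n)} (hCo : IsOpen C)
    (hC : IsCone C) (hCne : C.Nonempty) : 0 < sphMeasure n {x : Sph n | (x : Euc n) ∈ C} := by
  have := isOpenPosMeasure_sphMeasure (n := n) (by omega)
  have : Nontrivial (Euc n) := by
    have : Fact (1 < n) := ⟨by omega⟩
    have : Nontrivial (Fin n) := Fin.nontrivial_iff_two_le.mpr hn
    infer_instance
  obtain ⟨v, hv, hv0⟩ : ∃ v ∈ C, v ≠ 0 := by
    obtain ⟨x, hx, hx0⟩ := (dense_compl_singleton (0 : Euc n)).inter_open_nonempty C hCo hCne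
    exact ⟨x, hx, hx0⟩
  refine (hCo.preimage continuous_subtype_val).measure_pos _ ⟨⟨_, normalize_mem_sphere hv0⟩, ?_⟩
  exact hC _ (by positivity) v hv

theorem hausdorffMeasure_inter_sphere {n : ℕ} (hn : 1 ≤ n) (C : Set (Euc n)) :
    (Measure.hausdorffMeasure ((n : ℝ) - 1) : Measure (Euc n)) (C ∩ sphere (0 : Euc n) 1) =
      sphMeasure n {x : Sph n | (x : Euc n) ∈ C} := by
  rw [← sphMeasure_image hn]
  congr 1
  ext x
  simp [and_comm]

theorem proposition3p2 (n : ℕ) (hn : 2 ≤ n) :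
    ∃ K : ℝ, 0 < K ∧
      ∀ (S : Finset (Fin n → ℤ)) (C : Set (Euc n)), IsOpen C → IsCone C → C.Nonempty →
      ∀ (f : C(Sph n, Euc n)) (A : Sph n → Euc n →L[ℝ] Euc n),
        IsSobolev ((n - 1 : ℕ) : ENNReal) f A →
        (∀ x, ∀ σ ∈ S, f x ∉ ball (latticePoint σ) (1 / 2)) →
        (∑ σ ∈ S, |(degAt (latticePoint σ) f : ℝ)|) ^ (1 - 1 / (n : ℝ)) ≤
          K / (Measure.hausdorffMeasure ((n : ℝ) - 1) : Measure (Euc n)).real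
              (C ∩ sphere (0 : Euc n) 1) *
            ∫ x in f ⁻¹' (C + latticePoint '' (S : Set (Fin n → ℤ))),
              ‖A x‖ ^ (n - 1) ∂(sphMeasure n) := by
  have hn0 : (0 : ℝ) < n := by exact_mod_cast (by omega : 0 < n)
  refine ⟨4 ^ n * 2 ^ (n - 1) * (n * 4 ^ (n - 1)), by positivity, ?_⟩
  intro S C hCo hC hCne f A hA hfS
  set K : ℝ := 4 ^ n * 2 ^ (n - 1) * (n * 4 ^ (n - 1)) with hK
  have hfin := isFiniteMeasure_sphMeasure (n := n) (by omega)
  have hpos := sphMeasure_cone_pos hn hCo hC hCne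
  have key := hA.weakDeriv.sum_degAt_mul_sphMeasure_le hn hfS hCo hC
  rw [measureReal_def, hausdorffMeasure_inter_sphere (by omega)]
  set D := ∑ σ ∈ S, |(degAt (latticePoint σ) f : ℝ)| with hD
  have hD0 : 0 ≤ D := Finset.sum_nonneg fun _ _ => abs_nonneg _
  set m := sphMeasure n {x : Sph n | (x : Euc n) ∈ C}
  have hm0 : 0 < m.toReal := ENNReal.toReal_pos hpos.ne' (measure_ne_top _ _)
  set E := f ⁻¹' (C + latticePoint '' (S : Set (Fin n → ℤ))) with hE
  have hint : Integrable (fun x => ‖A x‖ ^ (n - 1)) (sphMeasure n) := by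
    have h := hA.memLp_deriv.integrable_norm_pow (p := n - 1) (by omega)
    exact h
  set I := ∫ x in E, ‖A x‖ ^ (n - 1) ∂(sphMeasure n) with hI
  have hI0 : 0 ≤ I := integral_nonneg fun _ => by positivity
  -- The exponent `n - 1` of the Sobolev space makes the energy integrable, so the real integral is
  -- not a default value.
  have hIE : ∫⁻ y in E, ‖A y‖ₑ ^ (n - 1) ∂(sphMeasure n) = ENNReal.ofReal I := by
    rw [hI, ofReal_integral_eq_lintegral_ofReal hint.restrict
      (Eventually.of_forall fun _ => by positivity)]
    refine lintegral_congr fun y => ?_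
    rw [ENNReal.ofReal_pow (norm_nonneg _), ofReal_norm]
  rw [hIE, ← ENNReal.ofReal_toReal (show m ≠ ⊤ from measure_ne_top _ _), ← ENNReal.ofReal_mul hD0,
    ← ENNReal.ofReal_mul (by positivity), ENNReal.ofReal_le_ofReal_iff (by positivity)] at key
  -- Dividing by `D^(1/n)` requires `D > 0`. If `D = 0`, the left side is `0`, since `n ≥ 2` makes
  -- the exponent nonzero.
  rcases hD0.eq_or_lt with h0 | hDpos
  · have hne : 1 - 1 / (n : ℝ) ≠ 0 := by
      have : (2 : ℝ) ≤ n := by exact_mod_cast hn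
      rw [sub_ne_zero, ne_comm, Ne, div_eq_one_iff_eq hn0.ne']
      linarith
    rw [← h0, Real.zero_rpow hne]
    positivity
  · rw [Real.rpow_sub hDpos, Real.rpow_one, div_mul_eq_mul_div, div_le_div_iff₀ (by positivity) hm0]
    linarith
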